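/- **Theorem (soundness of Conditional Probabilistic Separation Logic, CPSL).** Every derivable CPSL judgment is valid. The notions are as follows. *Memories and programs.* Let $\mathsf{Var}$ be a finite set of variables. For $S\subseteq\mathsf{Var}$ let $\mathrm{Mem}[S]$ be the set of functions $S\to\{tt,ff\}$, let $m^T$ be the restriction of $m$ to $T\subseteq S$, and let $\mathcal D(X)$ be the set of probability distributions on $X$; $\pi_T\mu$ is the marginal on $\mathrm{Mem}[T]$ and $\delta_m$ the point mass at $m$. Expressions $e$ are built from variables, $tt$, $ff$, $\wedge$, $\vee$ and further Boolean operators; distribution expressions $d$ are coin flips $\mathbf B_p$, $p\in[0,1]$ (with $\mathrm{FV}(d)=\emptyset$). Commands are $$c ::= \mathbf{skip}\mid x\leftarrow e\mid x\xleftarrow{\$}d\mid c;c'\mid \mathbf{if}\ b\ \mathbf{then}\ c\ \mathbf{else}\ c'\qquad(x,b\in\mathsf{Var}).$$ $\llbracket c\rrbracket:\mathcal D(\mathrm{Mem}[\mathsf{Var}])\to\mathcal D(\mathrm{Mem}[\mathsf{Var}])$ is defined as follows: $\mathbf{skip}$ is the identity; $x\leftarrow e$ pushes $\mu$ forward along $m\mapsto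 m[x\mapsto\llbracket e\rrbracket m]$; $x\xleftarrow{\$}d$ draws $m$ from $\mu$ and $v$ from $\llbracket d\rrbracket$ and returns $m[x\mapsto v]$; sequencing is composition; and $\llbracket\mathbf{if}\ b\ \mathbf{then}\ c\ \mathbf{else}\ c'\rrbracket\mu=p\cdot\llbracket c\rrbracket(\mu\mid b=tt)+(1-p)\cdot\llbracket c'\rrbracket(\mu\mid b=ff)$ with $p=\mu(b=tt)$, where a summand of weight $0$ is omitted. *Model.* A state is a kernel $f:\mathrm{Mem}[S]\to\mathcal D(\mathrm{Mem}[T])$ with $S\subseteq T$ and $\pi_S f(m)=\delta_m$ for all $m$; write $\mathrm{dom} f=S$, $\mathrm{range} f=T$. For $f$ as above and $g:\mathrm{Mem}[U]\to\mathcal D(\mathrm{Mem}[W])$, the parallel composition $f\oplus g:\mathrm{Mem}[S\cup U]\to\mathcal D(\mathrm{Mem}[T\cup W])$, $(f\oplus g)(d)(m)=f(d^S)(m^T)\,g(d^U)(m^W)$, is defined iff $S\cap U=T\cap W$, and $f\odot g$ is Kleisli composition, defined iff $T=U$. Put $f\sqsubseteq g$ iff $g=(f\oplus\mathrm{unit}_R)\odot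 h$ for some $R\subseteq\mathsf{Var}$ and state $h$, where $\mathrm{unit}_R(m)=\delta_m$ for $m\in\mathrm{Mem}[R]$. For $\mu\in\mathcal D(\mathrm{Mem}[\mathsf{Var}])$ let $f_\mu:\mathrm{Mem}[\emptyset]\to\mathcal D(\mathrm{Mem}[\mathsf{Var}])$ be the constant kernel with value $\mu$. *Atomic propositions* are $(S:p_d\triangleright p_r)$ with $S\subseteq\mathsf{Var}$, $$p_d::= x=e\mid\top\mid\bot\mid p_d\wedge p_d'\mid p_d\vee p_d',\qquad p_r::=[S]\mid x\sim d\mid x=e\mid\top\mid\bot\mid p_r\wedge p_r'\mid p_r*p_r',$$ where all variables of $p_d$ are in $S$ and **$p_d$ is satisfied by at least one memory over $S$**. $(S\triangleright p_r)$ abbreviates $(S:\top\triangleright p_r)$. For $\mu\in\mathcal D(\mathrm{Mem}[A])$: $\mu\models[S]$ iff $S\subseteq A$; $\mu\models x\sim d$ iff $x\in A$ and $x$ has law $\llbracket d\rrbracket$ under $\mu$; $\mu\models x=e$ iff $\{x\}\cup\mathrm{FV}(e)\subseteq A$ and $\mu(x=e)=1$; $\top,\bot,\wedge$ are as usual; and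 $\mu\models p_r*p_r'$ iff there are $\mu_1\models p_r$ and $\mu_2\models p_r'$ such that $\mu_1\oplus\mu_2$ is defined and is a marginal of $\mu$. Here, for $\mu_1,\mu_2$ over $A_1,A_2$, $\mu_1\oplus\mu_2$ is defined iff the marginals of both on $A_1\cap A_2$ are one and the same point mass $\delta_m$, and is then the independent product of $\pi_{A_1\setminus A_2}\mu_1$, $\delta_m$ and $\pi_{A_2\setminus A_1}\mu_2$. *RDIBI assertions* are generated from atomic propositions, $\top$, $\bot$, $P\vee Q$, $P*Q$, $P\mathbin{;}Q$ if $\mathrm{FV_D}(Q)\subseteq\mathrm{FV_R}(P)$, and $P\wedge Q$ if $\mathrm{FV_R}(P)=\mathrm{FV_R}(Q)=\mathrm{FV}(P)=\mathrm{FV}(Q)$. $\mathrm{FV}(P)$ is the set of all variables of $P$. For an atom $(S:p_d\triangleright p_r)$, $\mathrm{FV_D}=S$ and $\mathrm{FV_R}=S\cup\mathrm{FV}(p_r)$; both are empty for $\top,\bot$ and are unions over $\wedge$, $*$ and $;$; $\mathrm{FV_D}(P\vee Q)=\mathrm{FV_D}(P)\cup\mathrm{FV_D}(Q)$ and $\mathrm{FV_R}(P\vee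 Q)=\mathrm{FV_R}(P)\cap\mathrm{FV_R}(Q)$. Satisfaction: $f\models(S:p_d\triangleright p_r)$ iff there is $f'\sqsubseteq f$ such that every $m\in\mathrm{Mem}[S]$ satisfying $p_d$ is an input of $f'$ and $f'(m)\models p_r$; $\top,\bot,\wedge,\vee$ are as usual; $f\models P*Q$ iff there are $g\models P$, $h\models Q$ with $g\oplus h$ defined and $g\oplus h\sqsubseteq f$; $f\models P\mathbin{;}Q$ iff $f=g\odot h$ for some $g\models P$, $h\models Q$. $\models P\to Q$ means that every state satisfying $P$ satisfies $Q$. *Variable conditions* $\mathrm{RV},\mathrm{WV},\mathrm{MV}$. All are empty for $\mathbf{skip}$. For $x\leftarrow a$ and $x\xleftarrow{\$}a$ they are $\mathrm{FV}(a)$, $\{x\}\setminus\mathrm{FV}(a)$ and $\{x\}$. $\mathrm{RV}(c;c')=\mathrm{RV}(c)\cup(\mathrm{RV}(c')\setminus\mathrm{WV}(c))$, $\mathrm{WV}(c;c')=\mathrm{WV}(c)\cup(\mathrm{WV}(c')\setminus\mathrm{RV}(c))$, $\mathrm{MV}(c;c')=\mathrm{MV}(c)\cup\mathrm{MV}(c')$.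 For $\mathbf{if}\ b\ \mathbf{then}\ c\ \mathbf{else}\ c'$ they are $\{b\}\cup\mathrm{RV}(c)\cup\mathrm{RV}(c')$, $(\mathrm{WV}(c)\cap\mathrm{WV}(c'))\setminus\{b\}$ and $\mathrm{MV}(c)\cup\mathrm{MV}(c')$. *Derivable judgments* $\vdash\{P\}\,c\,\{Q\}$ are those generated by the following rules, where all assertions must be in RDIBI: - Assn: $\vdash\{P\}\,x\leftarrow e\,\{P\mathbin{;}(\mathrm{FV}(e)\triangleright x=e)\}$ if $x\notin\mathrm{FV}(e)\cup\mathrm{FV}(P)$. - Samp: $\vdash\{P\}\,x\xleftarrow{\$}d\,\{P\mathbin{;}(\mathrm{FV}(d)\triangleright x\sim d)\}$ if $x\notin\mathrm{FV}(d)\cup\mathrm{FV}(P)$. - Skip: $\vdash\{P\}\,\mathbf{skip}\,\{P\}$. - Seqn: from $\vdash\{P\}\,c\,\{Q\}$ and $\vdash\{Q\}\,c'\,\{R\}$ infer $\vdash\{P\}\,c;c'\,\{R\}$. - DCond: from $\vdash\{(\emptyset\triangleright b=tt)\mathbin{;}P\}\,c\,\{(\emptyset\triangleright b=tt)\mathbin{;}(\{b\}:b=tt\triangleright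 Q_1)\}$ and $\vdash\{(\emptyset\triangleright b=ff)\mathbin{;}P\}\,c'\,\{(\emptyset\triangleright b=ff)\mathbin{;}(\{b\}:b=ff\triangleright Q_2)\}$ infer $\vdash\{(\emptyset\triangleright[b])\mathbin{;}P\}\ \mathbf{if}\ b\ \mathbf{then}\ c\ \mathbf{else}\ c'\ \{(\emptyset\triangleright[b])\mathbin{;}((\{b\}:b=tt\triangleright Q_1)\wedge(\{b\}:b=ff\triangleright Q_2))\}$. - Weak: from $\vdash\{P\}\,c\,\{Q\}$, $\models P'\to P$ and $\models Q\to Q'$ infer $\vdash\{P'\}\,c\,\{Q'\}$. - Frame: from $\vdash\{P\}\,c\,\{Q\}$ infer $\vdash\{P*R\}\,c\,\{Q*R\}$ if $\mathrm{FV}(R)\cap\mathrm{MV}(c)=\emptyset$, $\mathrm{FV}(Q)\subseteq\mathrm{FV_R}(P)\cup\mathrm{WV}(c)$ and $\mathrm{RV}(c)\subseteq\mathrm{FV_R}(P)$. *Claim.* If $\vdash\{P\}\,c\,\{Q\}$ is derivable, then it is valid: for every $\mu\in\mathcal D(\mathrm{Mem}[\mathsf{Var}])$, $f_\mu\models P$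 implies $f_{\llbracket c\rrbracket\mu}\models Q$. -/

import Mathlib

namespace CPSL

open scoped ENNReal

noncomputable section

/-! ### Memories and distributions -/

/-- Memories over a finite set `S` of program variables; all values are Boolean. -/
abbrev Mem {V : Type*} (S : Finset V) : Type _ := {x // x ∈ S} → Bool

namespace Mem

variable {V : Type*}

/-- The projection `m ↦ m^T` of a memory over `S` to a subset `T ⊆ S`. -/
def proj {S T : Finset V} (h : T ⊆ S) (m : Mem S) : Mem T := fun x => m ⟨x.1, h x.2⟩

/-- The value of a variable in a memory. It is only used for variables in the domain `S`
of the memory; elsewhere it has the dummy value `false`. -/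
def get [DecidableEq V] {S : Finset V} (m : Mem S) (x : V) : Bool :=
  if h : x ∈ S then m ⟨x, h⟩ else false

/-- The updated memory `m[x ↦ v]`. -/
def update [DecidableEq V] {S : Finset V} (m : Mem S) (x : V) (v : Bool) : Mem S :=
  fun y => if y.1 = x then v else m y

end Mem

/-- The marginal `π_T μ` of a distribution over memories. -/
def marg {V : Type*} {S T : Finset V} (h : T ⊆ S) (μ : PMF (Mem S)) : PMF (Mem T) :=
  μ.map (Mem.proj h)

/-- The probability `μ(E)` of an event. -/
def prob {α : Type*} (μ : PMF α) (E : Set α) : ℝ≥0∞ := μ.toOuterMeasure E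

theorem prob_le_one {α : Type*} (μ : PMF α) (E : Set α) : prob μ E ≤ 1 := by
  unfold prob
  rw [PMF.toOuterMeasure_apply, ← μ.tsum_coe]
  exact ENNReal.tsum_le_tsum fun a => Set.indicator_le_self E μ a

/-- The convex combination `p · μ₁ + (1 - p) · μ₂`. It equals `μ₂` for `p = 0` and `μ₁` for
`p = 1`. -/
def convex {α : Type*} (p : ℝ≥0∞) (hp : p ≤ 1) (μ₁ μ₂ : PMF α) : PMF α :=
  ⟨fun a => p * μ₁ a + (1 - p) * μ₂ a, by
    rw [ENNReal.summable.hasSum_iff, ENNReal.tsum_add, ENNReal.tsum_mul_left,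
      ENNReal.tsum_mul_left, μ₁.tsum_coe, μ₂.tsum_coe, mul_one, mul_one]
    exact add_tsub_cancel_of_le hp⟩

open Classical in
/-- The conditional distribution `μ | E`, which is `a ↦ μ(a) / μ(E)` on `E` and `0` outside `E`,
when `μ(E) ≠ 0`. For `μ(E) = 0` the value is a dummy; in the semantics of programs such a value
gets weight zero in a convex combination. -/
def condOn {α : Type*} (μ : PMF α) (E : Set α) : PMF α :=
  if h : ∃ a ∈ E, a ∈ μ.support then μ.filter E h else μ

/-- The `p`-biased coin flip: `true` has probability `p`. -/
def bern (p : unitInterval) : PMF Bool :=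
  convex (ENNReal.ofReal (p : ℝ)) (ENNReal.ofReal_le_one.2 p.2.2) (PMF.pure true) (PMF.pure false)

/-! ### The programming language -/

section Language

variable {V : Type*} [DecidableEq V]

/-- Boolean expressions. The constructor `op` adds arbitrary further Boolean operators
of every finite arity. -/
inductive Exp (V : Type*) : Type _
  | var (x : V) : Exp V
  | tt : Exp V
  | ff : Exp V
  | and (e e' : Exp V) : Exp V
  | or (e e' : Exp V) : Exp V
  | op {n : ℕ} (F : (Fin n → Bool) → Bool) (es : Fin n → Exp V) : Exp V

/-- The variables of an expression. -/
def Exp.fv : Exp V → Finset V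
  | .var x => {x}
  | .tt => ∅
  | .ff => ∅
  | .and e e' => e.fv ∪ e'.fv
  | .or e e' => e.fv ∪ e'.fv
  | .op _ es => Finset.univ.biUnion fun i => (es i).fv

/-- The value `⟦e⟧(m)`; meaningful when `e.fv ⊆ S`. -/
def Exp.eval {S : Finset V} (m : Mem S) : Exp V → Bool
  | .var x => m.get x
  | .tt => true
  | .ff => false
  | .and e e' => e.eval m && e'.eval m
  | .or e e' => e.eval m || e'.eval m
  | .op F es => F fun i => (es i).eval m

/-- Distribution expressions: the biased coin flips `B_p` with `p ∈ [0, 1]`. -/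
inductive DExp (V : Type*) : Type _
  | bern (p : unitInterval) : DExp V

/-- The variables of a distribution expression. -/
def DExp.fv : DExp V → Finset V
  | .bern _ => ∅

/-- The distribution `⟦d⟧ m` for a memory `m` over the variables of `d`. -/
def DExp.eval : (d : DExp V) → Mem d.fv → PMF Bool
  | .bern p, _ => CPSL.bern p

/-- Commands. -/
inductive Com (V : Type*) : Type _
  | skip : Com V
  | assn (x : V) (e : Exp V) : Com V
  | samp (x : V) (d : DExp V) : Com V
  | seq (c c' : Com V) : Com V
  | cond (b : V) (c c' : Com V) : Com V

/-- Variables that a command may read from its input, together with variables that it must write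
before they are read: `(RV c, WV c)`. -/
def Com.rwv : Com V → Finset V × Finset V
  | .skip => (∅, ∅)
  | .assn x e => (e.fv, {x} \ e.fv)
  | .samp x d => (d.fv, {x} \ d.fv)
  | .seq c c' => (c.rwv.1 ∪ (c'.rwv.1 \ c.rwv.2), c.rwv.2 ∪ (c'.rwv.2 \ c.rwv.1))
  | .cond b c c' => ({b} ∪ c.rwv.1 ∪ c'.rwv.1, (c.rwv.2 ∩ c'.rwv.2) \ {b})

/-- `RV c`: the variables that `c` may read from its input. -/
def Com.rv (c : Com V) : Finset V := c.rwv.1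

/-- `WV c`: the variables that `c` must write before they are read. -/
def Com.wv (c : Com V) : Finset V := c.rwv.2

/-- `MV c`: the variables that `c` may modify. -/
def Com.mv : Com V → Finset V
  | .skip => ∅
  | .assn x _ => {x}
  | .samp x _ => {x}
  | .seq c c' => c.mv ∪ c'.mv
  | .cond _ c c' => c.mv ∪ c'.mv

/-- The semantics of commands as transformers of distributions over total memories. -/
def Com.den [Fintype V] : Com V → PMF (Mem (Finset.univ : Finset V)) →
    PMF (Mem (Finset.univ : Finset V))
  | .skip, μ => μ
  | .assn x e, μ => μ.bind fun m => PMF.pure (m.update x (e.eval m))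
  | .samp x d, μ => μ.bind fun m =>
      (d.eval (m.proj (Finset.subset_univ _))).bind fun v => PMF.pure (m.update x v)
  | .seq c c', μ => c'.den (c.den μ)
  | .cond b c c', μ =>
      convex (prob μ {m | m.get b = true}) (prob_le_one _ _)
        (c.den (condOn μ {m | m.get b = true})) (c'.den (condOn μ {m | m.get b = false}))

end Language

/-! ### The probabilistic model -/

section Model

variable {V : Type*} [DecidableEq V]

/-- The states of the model: Markov kernels from memories over `dom` to memories over `cod`
(the range of the kernel) that preserve their input to their output. -/
structure Kernel (V : Type*) where
  dom : Finset V
  cod : Finset V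
  dom_sub : dom ⊆ cod
  run : Mem dom → PMF (Mem cod)
  preserves : ∀ d, marg dom_sub (run d) = PMF.pure d

/-- The unit kernel on memories over `S`. -/
def Kernel.unit (S : Finset V) : Kernel V where
  dom := S
  cod := S
  dom_sub := subset_rfl
  run := PMF.pure
  preserves d := by
    unfold marg
    rw [PMF.pure_map]
    rfl

/-- The kernel `f_μ` with empty domain given by a distribution `μ`. -/
def Kernel.lift {S : Finset V} (μ : PMF (Mem S)) : Kernel V where
  dom := ∅
  cod := S
  dom_sub := Finset.empty_subset S
  run := fun _ => μ
  preserves d := by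
    have h : (Mem.proj (Finset.empty_subset S) : Mem S → Mem ∅) = Function.const _ d := by
      funext m x
      exact absurd x.2 (Finset.notMem_empty x.1)
    unfold marg
    rw [h, PMF.map_const]

/-- `IsPar f g h` says that `f ⊕ g` is defined and equal to `h`, where `⊕` is the parallel
composition `(f ⊕ g)(d)(m) = f(d^S)(m^T) · g(d^U)(m^W)` of `f : Mem S → D(Mem T)` and
`g : Mem U → D(Mem W)`, defined when `S ∩ U = T ∩ W`. -/
structure IsPar (f g h : Kernel V) : Prop where
  compat : f.dom ∩ g.dom = f.cod ∩ g.cod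
  dom_eq : h.dom = f.dom ∪ g.dom
  cod_eq : h.cod = f.cod ∪ g.cod
  run_eq : ∀ (d : Mem h.dom) (m : Mem h.cod),
    h.run d m =
      f.run (d.proj (Finset.subset_union_left.trans dom_eq.ge))
          (m.proj (Finset.subset_union_left.trans cod_eq.ge)) *
        g.run (d.proj (Finset.subset_union_right.trans dom_eq.ge))
          (m.proj (Finset.subset_union_right.trans cod_eq.ge))

/-- `IsSeq f g h` says that `f ⊙ g` is defined and equal to `h`, where `⊙` is Kleisli composition,
defined when the range of `f` is the domain of `g`. The projections along equalities of
variable sets are identities. -/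
structure IsSeq (f g h : Kernel V) : Prop where
  compat : f.cod = g.dom
  dom_eq : h.dom = f.dom
  cod_eq : h.cod = g.cod
  run_eq : ∀ d : Mem h.dom,
    marg cod_eq.ge (h.run d) =
      (f.run (d.proj dom_eq.ge)).bind fun m => g.run (m.proj compat.ge)

/-- The order `f ⊑ g`: there are a set `R` of variables and a kernel `h` with
`g = (f ⊕ unit R) ⊙ h`. -/
def Kernel.Le (f g : Kernel V) : Prop :=
  ∃ (R : Finset V) (k h : Kernel V), IsPar f (Kernel.unit R) k ∧ IsSeq k h g

end Model

/-! ### Domain logic and range logic -/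

section Atoms

variable {V : Type*} [DecidableEq V]

/-- Propositional formulas `p_d` on memories. -/
inductive DForm (V : Type*) : Type _
  | eq (x : V) (e : Exp V) : DForm V
  | top : DForm V
  | bot : DForm V
  | and (p q : DForm V) : DForm V
  | or (p q : DForm V) : DForm V

/-- The variables of a formula on memories. -/
def DForm.fv : DForm V → Finset V
  | .eq x e => {x} ∪ e.fv
  | .top => ∅
  | .bot => ∅
  | .and p q => p.fv ∪ q.fv
  | .or p q => p.fv ∪ q.fv

/-- `p_d` holds in the memory `m`; meaningful when `p_d.fv ⊆ S`. -/
def DForm.Holds {S : Finset V} (m : Mem S) : DForm V → Prop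
  | .eq x e => m.get x = e.eval m
  | .top => True
  | .bot => False
  | .and p q => p.Holds m ∧ q.Holds m
  | .or p q => p.Holds m ∨ q.Holds m

/-- Formulas `p_r` on distributions over memories. -/
inductive RForm (V : Type*) : Type _
  | mem (S : Finset V) : RForm V
  | dist (x : V) (d : DExp V) : RForm V
  | eq (x : V) (e : Exp V) : RForm V
  | top : RForm V
  | bot : RForm V
  | and (p q : RForm V) : RForm V
  | sep (p q : RForm V) : RForm V

/-- The variables of a formula on distributions. -/
def RForm.fv : RForm V → Finset V
  | .mem S => S
  | .dist x d => {x} ∪ d.fv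
  | .eq x e => {x} ∪ e.fv
  | .top => ∅
  | .bot => ∅
  | .and p q => p.fv ∪ q.fv
  | .sep p q => p.fv ∪ q.fv

/-- The order `μ₁ ⊑ μ₂` on distributions over memories: `μ₁` is a marginal of `μ₂`. -/
def DistLe {A B : Finset V} (μ₁ : PMF (Mem A)) (μ₂ : PMF (Mem B)) : Prop :=
  ∃ h : A ⊆ B, marg h μ₂ = μ₁

/-- `IsDistPar μ₁ μ₂ ν` says that `μ₁ ⊕ μ₂` is defined and equal to `ν`: on the common variables
`A ∩ B` both distributions are the same point mass at some `m`, and `ν` is the independent product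
of the marginal of `μ₁` on `A \ B`, the point mass at `m`, and the marginal of `μ₂` on `B \ A`. -/
def IsDistPar {A B C : Finset V} (μ₁ : PMF (Mem A)) (μ₂ : PMF (Mem B)) (ν : PMF (Mem C)) : Prop :=
  ∃ (hC : C = A ∪ B) (m : Mem (A ∩ B)),
    marg Finset.inter_subset_left μ₁ = PMF.pure m ∧
    marg Finset.inter_subset_right μ₂ = PMF.pure m ∧
    ∀ r : Mem C,
      ν r =
        marg (Finset.sdiff_subset : A \ B ⊆ A) μ₁
            (r.proj (Finset.sdiff_subset.trans (Finset.subset_union_left.trans hC.ge))) *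
          PMF.pure m
            (r.proj (Finset.inter_subset_left.trans (Finset.subset_union_left.trans hC.ge))) *
          marg (Finset.sdiff_subset : B \ A ⊆ B) μ₂
            (r.proj (Finset.sdiff_subset.trans (Finset.subset_union_right.trans hC.ge)))

/-- Satisfaction of formulas on distributions. -/
def RForm.Sat : RForm V → {S : Finset V} → PMF (Mem S) → Prop
  | .mem T, S, _ => T ⊆ S
  | .dist x d, S, μ =>
      ∃ (hx : x ∈ S) (hd : d.fv ⊆ S) (m : Mem d.fv),
        marg hd μ = PMF.pure m ∧ μ.map (fun r => r ⟨x, hx⟩) = d.eval m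
  | .eq x e, S, μ =>
      {x} ∪ e.fv ⊆ S ∧ prob μ {m | m.get x = e.eval m} = 1
  | .top, _, _ => True
  | .bot, _, _ => False
  | .and p q, _, μ => p.Sat μ ∧ q.Sat μ
  | .sep p q, _, μ =>
      ∃ (A B C : Finset V) (μ₁ : PMF (Mem A)) (μ₂ : PMF (Mem B)) (ν : PMF (Mem C)),
        IsDistPar μ₁ μ₂ ν ∧ DistLe ν μ ∧ p.Sat μ₁ ∧ q.Sat μ₂

end Atoms

/-! ### Assertions -/

section Assertions

variable {V : Type*} [DecidableEq V]

/-- Assertions. The atomic proposition `atom S p r` is `(S : p_d ▷ p_r)`; `sep` is the separating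
conjunction and `dep` the dependent conjunction `P ; Q`. -/
inductive Form (V : Type*) : Type _
  | atom (S : Finset V) (p : DForm V) (r : RForm V) : Form V
  | top : Form V
  | bot : Form V
  | and (P Q : Form V) : Form V
  | or (P Q : Form V) : Form V
  | sep (P Q : Form V) : Form V
  | dep (P Q : Form V) : Form V

/-- All variables of an assertion. -/
def Form.fv : Form V → Finset V
  | .atom S p r => (S ∪ p.fv) ∪ r.fv
  | .top => ∅
  | .bot => ∅
  | .and P Q => P.fv ∪ Q.fv
  | .or P Q => P.fv ∪ Q.fv
  | .sep P Q => P.fv ∪ Q.fv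
  | .dep P Q => P.fv ∪ Q.fv

/-- `FV_D`: the variables that may appear in the domain. -/
def Form.fvD : Form V → Finset V
  | .atom S p _ => S ∪ p.fv
  | .top => ∅
  | .bot => ∅
  | .and P Q => P.fvD ∪ Q.fvD
  | .or P Q => P.fvD ∪ Q.fvD
  | .sep P Q => P.fvD ∪ Q.fvD
  | .dep P Q => P.fvD ∪ Q.fvD

/-- `FV_R`: the variables that must appear in the range. -/
def Form.fvR : Form V → Finset V
  | .atom S p r => (S ∪ p.fv) ∪ r.fv
  | .top => ∅
  | .bot => ∅
  | .and P Q => P.fvR ∪ Q.fvR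
  | .or P Q => P.fvR ∩ Q.fvR
  | .sep P Q => P.fvR ∪ Q.fvR
  | .dep P Q => P.fvR ∪ Q.fvR

/-- The formulas of the restricted logic RDIBI. In an atomic proposition, `p_d` is a formula about
memories over `S`, and some memory over `S` satisfies it. -/
def Form.RDIBI : Form V → Prop
  | .atom S p _ => p.fv ⊆ S ∧ ∃ m : Mem S, p.Holds m
  | .top => True
  | .bot => True
  | .and P Q => P.RDIBI ∧ Q.RDIBI ∧ P.fvR = Q.fvR ∧ Q.fvR = P.fv ∧ P.fv = Q.fv
  | .or P Q => P.RDIBI ∧ Q.RDIBI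
  | .sep P Q => P.RDIBI ∧ Q.RDIBI
  | .dep P Q => P.RDIBI ∧ Q.RDIBI ∧ Q.fvD ⊆ P.fvR

/-- Satisfaction `f ⊨ P` in the probabilistic model. A memory satisfies `S : p_d` when its domain
is `S` and `p_d` holds in it; so an atomic proposition asks for a kernel `f' ⊑ f` such that every
such memory is an input of `f'`, and the output satisfies `p_r`. -/
def Form.Sat : Form V → Kernel V → Prop
  | .atom S p r, f =>
      ∃ f' : Kernel V, f'.Le f ∧
        ∀ m : Mem S, p.Holds m → ∃ h : f'.dom = S, r.Sat (f'.run (m.proj h.le))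
  | .top, _ => True
  | .bot, _ => False
  | .and P Q, f => P.Sat f ∧ Q.Sat f
  | .or P Q, f => P.Sat f ∨ Q.Sat f
  | .sep P Q, f => ∃ f' g h : Kernel V, IsPar g h f' ∧ f'.Le f ∧ P.Sat g ∧ Q.Sat h
  | .dep P Q, f => ∃ g h : Kernel V, IsSeq g h f ∧ P.Sat g ∧ Q.Sat h

/-- The (intuitionistic) implication `P → Q` is valid in the probabilistic model. -/
def ValidImp (P Q : Form V) : Prop :=
  ∀ f g : Kernel V, f.Le g → P.Sat g → Q.Sat g

end Assertions

/-! ### The program logic -/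

section Logic

variable {V : Type*} [DecidableEq V]

/-- Derivable judgments `⊢ {P} c {Q}`. All assertions are required to be in RDIBI. -/
inductive Derivable : Form V → Com V → Form V → Prop
  | assn {P : Form V} {x : V} {e : Exp V}
      (hP : P.RDIBI) (hQ : (Form.dep P (.atom e.fv .top (.eq x e))).RDIBI)
      (hx : x ∉ e.fv ∪ P.fv) :
      Derivable P (.assn x e) (.dep P (.atom e.fv .top (.eq x e)))
  | samp {P : Form V} {x : V} {d : DExp V}
      (hP : P.RDIBI) (hQ : (Form.dep P (.atom d.fv .top (.dist x d))).RDIBI)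
      (hx : x ∉ d.fv ∪ P.fv) :
      Derivable P (.samp x d) (.dep P (.atom d.fv .top (.dist x d)))
  | skip {P : Form V} (hP : P.RDIBI) : Derivable P .skip P
  | seqn {P Q R : Form V} {c c' : Com V} :
      Derivable P c Q → Derivable Q c' R → Derivable P (.seq c c') R
  | dcond {P : Form V} {b : V} {c c' : Com V} {Q₁ Q₂ : RForm V}
      (hP : (Form.dep (.atom ∅ .top (.mem {b})) P).RDIBI)
      (hQ : (Form.dep (.atom ∅ .top (.mem {b}))
        (.and (.atom {b} (.eq b .tt) Q₁) (.atom {b} (.eq b .ff) Q₂))).RDIBI) :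
      Derivable (.dep (.atom ∅ .top (.eq b .tt)) P) c
        (.dep (.atom ∅ .top (.eq b .tt)) (.atom {b} (.eq b .tt) Q₁)) →
      Derivable (.dep (.atom ∅ .top (.eq b .ff)) P) c'
        (.dep (.atom ∅ .top (.eq b .ff)) (.atom {b} (.eq b .ff) Q₂)) →
      Derivable (.dep (.atom ∅ .top (.mem {b})) P) (.cond b c c')
        (.dep (.atom ∅ .top (.mem {b}))
          (.and (.atom {b} (.eq b .tt) Q₁) (.atom {b} (.eq b .ff) Q₂)))
  | weak {P P' Q Q' : Form V} {c : Com V}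
      (hP' : P'.RDIBI) (hQ' : Q'.RDIBI) (hP : ValidImp P' P) (hQ : ValidImp Q Q') :
      Derivable P c Q → Derivable P' c Q'
  | frame {P Q R : Form V} {c : Com V} (hR : R.RDIBI)
      (hmv : R.fv ∩ c.mv = ∅)
      (hwv : Q.fv ⊆ P.fvR ∪ c.wv)
      (hrv : c.rv ⊆ P.fvR) :
      Derivable P c Q → Derivable (.sep P R) c (.sep Q R)

/-- Validity of a judgment: if the lifted input satisfies `P`, the lifted output satisfies `Q`. -/
def Valid [Fintype V] (P : Form V) (c : Com V) (Q : Form V) : Prop :=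
  ∀ μ : PMF (Mem (Finset.univ : Finset V)),
    P.Sat (Kernel.lift μ) → Q.Sat (Kernel.lift (c.den μ))

end Logic

end

end CPSL

namespace CPSL

open scoped ENNReal

noncomputable section

/-! ### Discrete distributions -/

section Discrete

variable {α β : Type*}

/-! The proof is an induction on the derivation. It rests on a workable form of the order: f ⊑ g iff
f is a marginal of g and those outputs of f that are inputs of g are already inputs of f (`IsMarg`).
One direction composes two marginalizations (`Kernel.Le.isMarg`); the other supplies the missing
kernel by disintegrating g (`IsMarg.le`).

In this form two facts about assertions follow by induction on the formula. Satisfaction persists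
upwards (`Form.Sat.mono`). In RDIBI it also restricts: below a state satisfying P there is one that
satisfies P, with range inside FV(P) and domain inside FV_D(P) (`Form.Sat.exists_restriction`). The
side conditions on atoms, ∧ and ; serve this purpose.

Restriction makes the rules local. For assignment and sampling, P survives on all variables but x,
and the command is a kernel drawing x from the others (`Form.sat_dep_of_update`). For the frame
rule, a lifted state has empty domain, so P * R expresses independence of disjoint sets of
variables. A command acts as a Markov kernel on memories (`Com.den_eq_bind`) whose output on A ∪ WV
depends only on the input on A ⊇ RV (`Com.marg_step_congr`), so it preserves independence from
variables that it does not modify (`Com.marg_den_eq_indep`).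

For the conditional, conditioning on the guard yields the precondition of a branch
(`exists_branch_input`), and the branch outputs are the two values of a kernel with input b
(`sat_of_branches`). This kernel must satisfy both atoms even if the guard is almost surely
constant; the impossible branch is therefore run on a substitute input. -/

theorem bind_congr_support (p : PMF α) {f g : α → PMF β} (h : ∀ a ∈ p.support, f a = g a) :
    p.bind f = p.bind g := by
  ext b
  simp only [PMF.bind_apply]
  refine tsum_congr fun a => ?_
  by_cases ha : p a = 0
  · simp [ha]
  · rw [h a ((p.mem_support_iff a).2 ha)]

theorem map_congr_support (p : PMF α) {f g : α → β} (h : ∀ a ∈ p.support, f a = g a) :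
    p.map f = p.map g := by
  unfold PMF.map
  exact bind_congr_support p fun a ha => by simp [h a ha]

theorem eq_of_map_eq_pure {p : PMF α} {f : α → β} {b : β} (h : p.map f = PMF.pure b) {a : α}
    (ha : a ∈ p.support) : f a = b := by
  have : f a ∈ (p.map f).support := by
    rw [PMF.support_map]
    exact ⟨a, ha, rfl⟩
  rw [h, PMF.support_pure] at this
  exact this

theorem map_eq_pure {p : PMF α} {f : α → β} {b : β} (h : ∀ a ∈ p.support, f a = b) :
    p.map f = PMF.pure b := by
  rw [map_congr_support p (g := Function.const _ b) h, PMF.map_const]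

theorem exists_mem_support (p : PMF α) : ∃ a, a ∈ p.support := p.support_nonempty

/-- A distribution is recovered from the law of `f` and its conditional distributions given the
value of `f`. -/
theorem bind_map_eq_self (p : PMF α) (f : α → β) (κ : β → PMF α)
    (hκ : ∀ b, ∀ h : ∃ a ∈ {a | f a = b}, a ∈ p.support, κ b = p.filter {a | f a = b} h) :
    (p.map f).bind κ = p := by
  classical
  ext a
  rw [PMF.bind_apply, tsum_eq_single (f a)]
  · by_cases ha : a ∈ p.support
    · rw [hκ (f a) ⟨a, rfl, ha⟩, PMF.filter_apply]
      have h1 : (p.map f) (f a) = ∑' a', ({a' | f a' = f a} : Set α).indicator p a' := by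
        rw [PMF.map_apply]
        refine tsum_congr fun a' => ?_
        by_cases h : f a' = f a
        · simp [h]
        · simp [h, Ne.symm h]
      rw [← h1, Set.indicator_of_mem (show a ∈ {a' | f a' = f a} from rfl), mul_comm (p a),
        ← mul_assoc, ENNReal.mul_inv_cancel, one_mul]
      · rw [← PMF.mem_support_iff, PMF.support_map]
        exact ⟨a, ha, rfl⟩
      · exact PMF.apply_ne_top _ _
    · rw [(PMF.apply_eq_zero_iff _ _).2 ha]
      by_cases h : ∃ a' ∈ {a' | f a' = f a}, a' ∈ p.support
      · rw [hκ _ h, PMF.filter_apply, Set.indicator_of_mem (show a ∈ {a' | f a' = f a} from rfl),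
          (PMF.apply_eq_zero_iff _ _).2 ha, zero_mul, mul_zero]
      · have : (p.map f) (f a) = 0 := by
          rw [PMF.apply_eq_zero_iff, PMF.support_map]
          rintro ⟨a', h1, h2⟩
          exact h ⟨a', h2, h1⟩
        rw [this, zero_mul]
  · intro b hb
    by_cases h : ∃ a' ∈ {a' | f a' = b}, a' ∈ p.support
    · rw [hκ _ h, PMF.filter_apply, Set.indicator_of_notMem (fun h' => hb h'.symm), zero_mul,
        mul_zero]
    · have : (p.map f) b = 0 := by
        rw [PMF.apply_eq_zero_iff, PMF.support_map]
        rintro ⟨a', h1, h2⟩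
        exact h ⟨a', h2, h1⟩
      rw [this, zero_mul]

theorem condOn_eq_filter (p : PMF α) (E : Set α) (h : ∃ a ∈ E, a ∈ p.support) :
    condOn p E = p.filter E h := by
  unfold condOn
  rw [dif_pos h]

theorem mem_of_mem_support_condOn {p : PMF α} {E : Set α} (h : ∃ a ∈ E, a ∈ p.support) {a : α}
    (ha : a ∈ (condOn p E).support) : a ∈ E := by
  rw [condOn_eq_filter p E h, PMF.support_filter] at ha
  exact ha.1

theorem bind_map_condOn (p : PMF α) (f : α → β) :
    ((p.map f).bind fun b => condOn p {a | f a = b}) = p :=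
  bind_map_eq_self p f _ fun _ h => condOn_eq_filter p _ h

/-- Conditioning on an event about the first stage of a two-stage experiment conditions the first
stage. -/
theorem condOn_bind {p : PMF α} {κ : α → PMF β} {E : Set α} {F : Set β}
    (hEF : ∀ a ∈ p.support, ∀ b ∈ (κ a).support, b ∈ F ↔ a ∈ E)
    (h : ∃ a ∈ E, a ∈ p.support) :
    condOn (p.bind κ) F = (condOn p E).bind κ := by
  classical
  obtain ⟨a₀, ha₀, hp₀⟩ := h
  obtain ⟨b₀, hb₀⟩ := exists_mem_support (κ a₀)
  have hF : ∃ b ∈ F, b ∈ (p.bind κ).support :=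
    ⟨b₀, (hEF a₀ hp₀ b₀ hb₀).2 ha₀, (PMF.mem_support_bind_iff _ _ _).2 ⟨a₀, hp₀, hb₀⟩⟩
  rw [condOn_eq_filter _ _ hF, condOn_eq_filter _ _ ⟨a₀, ha₀, hp₀⟩]
  have key : ∀ b, F.indicator (p.bind κ) b = ∑' a, E.indicator p a * κ a b := by
    intro b
    by_cases hb : b ∈ F
    · rw [Set.indicator_of_mem hb, PMF.bind_apply]
      refine tsum_congr fun a => ?_
      by_cases ha : a ∈ E
      · rw [Set.indicator_of_mem ha]
      · rw [Set.indicator_of_notMem ha, zero_mul]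
        by_contra hne
        have h1 := left_ne_zero_of_mul hne
        have h2 := right_ne_zero_of_mul hne
        exact ha ((hEF a ((p.mem_support_iff a).2 h1) b (((κ a).mem_support_iff b).2 h2)).1 hb)
    · rw [Set.indicator_of_notMem hb]
      refine (ENNReal.tsum_eq_zero.2 fun a => ?_).symm
      by_cases ha : a ∈ E
      · rw [Set.indicator_of_mem ha]
        by_contra hne
        have h1 := left_ne_zero_of_mul hne
        have h2 := right_ne_zero_of_mul hne
        exact hb ((hEF a ((p.mem_support_iff a).2 h1) b (((κ a).mem_support_iff b).2 h2)).2 ha)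
      · rw [Set.indicator_of_notMem ha, zero_mul]
  have total : ∑' b, F.indicator (p.bind κ) b = ∑' a, E.indicator p a := by
    simp only [key]
    rw [ENNReal.tsum_comm]
    refine tsum_congr fun a => ?_
    rw [ENNReal.tsum_mul_left, (κ a).tsum_coe, mul_one]
  ext b
  rw [PMF.filter_apply, PMF.bind_apply, total, key, ← ENNReal.tsum_mul_right]
  refine tsum_congr fun a => ?_
  rw [PMF.filter_apply]
  ring

/-- The total mass forces the second weight, so a mixture is a two-stage experiment whose first
stage draws the guard. -/
theorem convex_eq_bind (ρ : PMF Bool) (p : ℝ≥0∞) (hp : p ≤ 1) (h : ρ true = p) (μ₁ μ₂ : PMF α) :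
    convex p hp μ₁ μ₂ = ρ.bind fun v => if v then μ₁ else μ₂ := by
  have h2 : ρ false = 1 - p := by
    have := ρ.tsum_coe
    rw [tsum_bool] at this
    rw [← this, h]
    exact (ENNReal.add_sub_cancel_right (h ▸ PMF.apply_ne_top _ _)).symm
  ext a
  rw [PMF.bind_apply, tsum_bool, h, h2]
  simp only [if_true, Bool.false_eq_true, if_false]
  rw [add_comm]
  rfl

theorem prob_eq_map (p : PMF α) (f : α → β) (b : β) : prob p {a | f a = b} = p.map f b := by
  classical
  unfold prob
  rw [PMF.toOuterMeasure_apply, PMF.map_apply]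
  refine tsum_congr fun a => ?_
  by_cases h : f a = b
  · simp [h]
  · simp [h, Ne.symm h]

theorem prob_eq_one_iff (p : PMF α) (E : Set α) : prob p E = 1 ↔ ∀ a ∈ p.support, a ∈ E :=
  PMF.toOuterMeasure_apply_eq_one_iff p E

theorem exists_of_mem_support_map {α β : Type*} {p : PMF α} {f : α → β} {b : β}
    (h : b ∈ (p.map f).support) : ∃ a ∈ {a | f a = b}, a ∈ p.support := by
  rw [PMF.support_map] at h
  obtain ⟨a, ha, hb⟩ := h
  exact ⟨a, hb, ha⟩

end Discrete

/-! ### Memories -/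

section Memories

variable {V : Type*} [DecidableEq V]

namespace Mem

/-- The extension of a memory by `false`, restricted to `T`. -/
def extend {S : Finset V} (T : Finset V) (m : Mem S) : Mem T := fun x => m.get x.1

theorem get_of_mem {S : Finset V} (m : Mem S) {x : V} (h : x ∈ S) : m.get x = m ⟨x, h⟩ :=
  dif_pos h

theorem proj_extend {S T : Finset V} (h : S ⊆ T) (m : Mem S) : (m.extend T).proj h = m := by
  funext x
  exact get_of_mem m x.2

theorem get_proj {S T : Finset V} (h : T ⊆ S) (m : Mem S) {x : V} (hx : x ∈ T) :
    (m.proj h).get x = m.get x := by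
  rw [get_of_mem _ hx, get_of_mem _ (h hx)]
  rfl

theorem get_update {S : Finset V} (m : Mem S) {x : V} (hx : x ∈ S) (v : Bool) (y : V) :
    (m.update x v).get y = if y = x then v else m.get y := by
  by_cases hy : y ∈ S
  · rw [get_of_mem _ hy, get_of_mem _ hy]
    rfl
  · have : y ≠ x := fun h => hy (h ▸ hx)
    simp [get, hy, this]

theorem ext_get {S : Finset V} {m m' : Mem S} (h : ∀ x ∈ S, m.get x = m'.get x) : m = m' := by
  funext x
  rw [← get_of_mem m x.2, ← get_of_mem m' x.2]
  exact h x.1 x.2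

variable {A B C : Finset V}

/-- The memory that agrees with `m` on `A` and with `m'` on the rest. -/
def merge (h : C ⊆ A ∪ B) (m : Mem A) (m' : Mem B) : Mem C := fun x =>
  if hx : x.1 ∈ A then m ⟨x.1, hx⟩ else m' ⟨x.1, (Finset.mem_union.1 (h x.2)).resolve_left hx⟩

/-- Two memories agree on their common variables. -/
def Agree (m : Mem A) (m' : Mem B) : Prop :=
  ∀ x (hA : x ∈ A) (hB : x ∈ B), m ⟨x, hA⟩ = m' ⟨x, hB⟩

theorem merge_left (h : C ⊆ A ∪ B) (hA : C ⊆ A) (m : Mem A) (m' : Mem B) :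
    merge h m m' = m.proj hA := by
  funext x
  exact dif_pos (hA x.2)

/-- Merging gives priority to the left memory, so here, unlike in `merge_left`, agreement is needed.
-/
theorem merge_right (h : C ⊆ A ∪ B) (hB : C ⊆ B) {m : Mem A} {m' : Mem B} (hm : Agree m m') :
    merge h m m' = m'.proj hB := by
  funext x
  unfold merge
  split_ifs with hx
  · exact hm _ _ _
  · rfl

theorem proj_merge {D : Finset V} (h : C ⊆ A ∪ B) (hD : D ⊆ C) (m : Mem A) (m' : Mem B) :
    (merge h m m').proj hD = merge (hD.trans h) m m' := rfl

/-- Agreement matters for variables in A that are not in A': they are read from the right before the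
enlargement and from the left after it. -/
theorem merge_proj {A' B' : Finset V} (hA : A' ⊆ A) (hB : B' ⊆ B) (h : C ⊆ A' ∪ B')
    {m : Mem A} {m' : Mem B} (hm : Agree m m') :
    merge h (m.proj hA) (m'.proj hB) =
      merge (h.trans (Finset.union_subset_union hA hB)) m m' := by
  funext x
  unfold merge
  by_cases h1 : x.1 ∈ A'
  · rw [dif_pos h1, dif_pos (hA h1)]
    rfl
  · rw [dif_neg h1]
    by_cases h2 : x.1 ∈ A
    · rw [dif_pos h2]
      exact (hm _ _ _).symm
    · rw [dif_neg h2]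
      rfl

theorem merge_self (h : C = A ∪ B) (r : Mem C) :
    merge h.le (r.proj (Finset.subset_union_left.trans h.ge))
      (r.proj (Finset.subset_union_right.trans h.ge)) = r := by
  funext x
  unfold merge
  split_ifs <;> rfl

end Mem

theorem Exp.eval_proj {S T : Finset V} (h : T ⊆ S) (m : Mem S) (e : Exp V) (he : e.fv ⊆ T) :
    e.eval (m.proj h) = e.eval m := by
  induction e with
  | var x => exact Mem.get_proj h m (he (Finset.mem_singleton_self x))
  | tt => rfl
  | ff => rfl
  | and e e' ih ih' =>
    simp only [Exp.eval]
    rw [ih (Finset.subset_union_left.trans he), ih' (Finset.subset_union_right.trans he)]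
  | or e e' ih ih' =>
    simp only [Exp.eval]
    rw [ih (Finset.subset_union_left.trans he), ih' (Finset.subset_union_right.trans he)]
  | op F es ih =>
    simp only [Exp.eval]
    congr 1
    funext i
    exact ih i ((Finset.subset_biUnion_of_mem (fun i => (es i).fv) (Finset.mem_univ i)).trans he)

end Memories

/-! ### Marginals and independent products -/

section Marginals

variable {V : Type*}

theorem marg_marg {S T U : Finset V} (h : T ⊆ S) (h' : U ⊆ T) (μ : PMF (Mem S)) :
    marg h' (marg h μ) = marg (h'.trans h) μ := by
  unfold marg
  rw [PMF.map_comp]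
  rfl

theorem marg_self {S : Finset V} (h : S ⊆ S) (μ : PMF (Mem S)) : marg h μ = μ := by
  unfold marg
  exact PMF.map_id μ

theorem marg_pure {S T : Finset V} (h : T ⊆ S) (m : Mem S) :
    marg h (PMF.pure m) = PMF.pure (m.proj h) := PMF.pure_map _ _

theorem marg_bind {α : Type*} {S T : Finset V} (h : T ⊆ S) (p : PMF α) (κ : α → PMF (Mem S)) :
    marg h (p.bind κ) = p.bind fun a => marg h (κ a) := PMF.map_bind _ _ _

theorem bind_marg {β : Type*} {S T : Finset V} (h : T ⊆ S) (μ : PMF (Mem S))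
    (κ : Mem T → PMF β) : (marg h μ).bind κ = μ.bind fun m => κ (m.proj h) := PMF.bind_map _ _ _

end Marginals

section Independence

variable {V : Type*} [DecidableEq V] {A B C : Finset V}

/-- The law of the combination of independent memories drawn from `μ` and `ν`. -/
def indep (h : C ⊆ A ∪ B) (μ : PMF (Mem A)) (ν : PMF (Mem B)) : PMF (Mem C) :=
  μ.bind fun a => ν.map (Mem.merge h a)

/-- The common variables of `μ` and `ν` have the same deterministic values. -/
def Agree (μ : PMF (Mem A)) (ν : PMF (Mem B)) : Prop :=
  ∀ a ∈ μ.support, ∀ b ∈ ν.support, Mem.Agree a b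

theorem Agree.marg {A' B' : Finset V} {μ : PMF (Mem A)} {ν : PMF (Mem B)} (h : Agree μ ν)
    (hA : A' ⊆ A) (hB : B' ⊆ B) : Agree (marg hA μ) (CPSL.marg hB ν) := by
  intro a ha b hb
  unfold CPSL.marg at ha hb
  rw [PMF.support_map] at ha hb
  obtain ⟨a, ha, rfl⟩ := ha
  obtain ⟨b, hb, rfl⟩ := hb
  exact fun x hxA hxB => h a ha b hb x (hA hxA) (hB hxB)

/-- On pairs of positive weight the merge determines both memories, so only the pair of projections
of r contributes to the sum. -/
theorem indep_apply (h : C = A ∪ B) {μ : PMF (Mem A)} {ν : PMF (Mem B)} (hμν : Agree μ ν)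
    (r : Mem C) :
    indep h.le μ ν r = μ (r.proj (Finset.subset_union_left.trans h.ge)) *
      ν (r.proj (Finset.subset_union_right.trans h.ge)) := by
  classical
  unfold indep
  rw [PMF.bind_apply]
  have key : ∀ a b, μ a ≠ 0 → ν b ≠ 0 → r = Mem.merge h.le a b →
      a = r.proj (Finset.subset_union_left.trans h.ge) ∧
      b = r.proj (Finset.subset_union_right.trans h.ge) := by
    rintro a b ha hb rfl
    rw [Mem.proj_merge, Mem.proj_merge, Mem.merge_left _ subset_rfl,
      Mem.merge_right _ subset_rfl (hμν a ha b hb)]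
    exact ⟨rfl, rfl⟩
  rw [tsum_eq_single (r.proj (Finset.subset_union_left.trans h.ge))]
  · by_cases hμ : μ (r.proj (Finset.subset_union_left.trans h.ge)) = 0
    · rw [hμ, zero_mul, zero_mul]
    congr 1
    rw [PMF.map_apply, tsum_eq_single (r.proj (Finset.subset_union_right.trans h.ge))]
    · rw [if_pos (Mem.merge_self h r).symm]
    · intro b hb
      by_cases hν : ν b = 0
      · simp [hν]
      · exact if_neg fun hr => hb (key _ _ hμ hν hr).2
  · intro a ha
    by_cases hμ : μ a = 0
    · rw [hμ, zero_mul]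
    · rw [PMF.map_apply, ENNReal.tsum_eq_zero.2, mul_zero]
      intro b
      by_cases hν : ν b = 0
      · simp [hν]
      · exact if_neg fun hr => ha (key _ _ hμ hν hr).1

theorem marg_indep {D : Finset V} (h : C ⊆ A ∪ B) (hD : D ⊆ C) (μ : PMF (Mem A))
    (ν : PMF (Mem B)) : marg hD (indep h μ ν) = indep (hD.trans h) μ ν := by
  unfold indep
  rw [marg_bind]
  unfold marg
  simp only [PMF.map_comp]
  rfl

theorem indep_left (h : C ⊆ A ∪ B) (hA : C ⊆ A) (μ : PMF (Mem A)) (ν : PMF (Mem B)) :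
    indep h μ ν = marg hA μ := by
  unfold indep marg
  rw [PMF.map]
  congr 1
  funext a
  rw [show Mem.merge h a = Function.const _ (a.proj hA) from
    funext fun b => Mem.merge_left h hA a b, PMF.map_const]
  rfl

theorem indep_right (h : C ⊆ A ∪ B) (hB : C ⊆ B) {μ : PMF (Mem A)} {ν : PMF (Mem B)}
    (hμν : Agree μ ν) : indep h μ ν = marg hB ν := by
  unfold indep marg
  rw [bind_congr_support μ (g := fun _ => ν.map (Mem.proj hB))
    fun a ha => map_congr_support ν fun b hb => Mem.merge_right h hB (hμν a ha b hb),
    PMF.bind_const]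

theorem indep_marg {A' B' : Finset V} (hA : A' ⊆ A) (hB : B' ⊆ B) (h : C ⊆ A' ∪ B')
    {μ : PMF (Mem A)} {ν : PMF (Mem B)} (hμν : Agree μ ν) :
    indep h (marg hA μ) (marg hB ν) =
      indep (h.trans (Finset.union_subset_union hA hB)) μ ν := by
  unfold indep
  rw [bind_marg]
  refine bind_congr_support μ fun a ha => ?_
  unfold marg
  rw [PMF.map_comp]
  exact map_congr_support ν fun b hb => Mem.merge_proj hA hB h (hμν a ha b hb)

theorem indep_pure (h : C ⊆ A ∪ B) (μ : PMF (Mem A)) (m : Mem B) :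
    indep h μ (PMF.pure m) = μ.map fun a => Mem.merge h a m := by
  unfold indep
  simp only [PMF.pure_map]
  rfl

end Independence

/-! ### Kernels -/

theorem Kernel.proj_of_mem_support {V : Type*} (f : Kernel V) {d : Mem f.dom} {m : Mem f.cod}
    (hm : m ∈ (f.run d).support) : m.proj f.dom_sub = d :=
  eq_of_map_eq_pure (f.preserves d) hm

section Kernels

variable {V : Type*} [DecidableEq V]

/-- Common outputs are common inputs by the condition for ⊕, and both kernels copy their inputs. -/
theorem Kernel.agree {f g : Kernel V} (h : f.dom ∩ g.dom = f.cod ∩ g.cod) {D : Finset V}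
    (hf : f.dom ⊆ D) (hg : g.dom ⊆ D) (d : Mem D) :
    Agree (f.run (d.proj hf)) (g.run (d.proj hg)) := by
  intro a ha b hb x hxa hxb
  have hx : x ∈ f.dom ∩ g.dom := h ▸ Finset.mem_inter.2 ⟨hxa, hxb⟩
  have h1 := congrFun (f.proj_of_mem_support ha) ⟨x, (Finset.mem_inter.1 hx).1⟩
  have h2 := congrFun (g.proj_of_mem_support hb) ⟨x, (Finset.mem_inter.1 hx).2⟩
  exact h1.trans h2.symm

theorem IsPar.run_eq_indep {f g k : Kernel V} (h : IsPar f g k) (d : Mem k.dom) :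
    k.run d = indep h.cod_eq.le
      (f.run (d.proj (Finset.subset_union_left.trans h.dom_eq.ge)))
      (g.run (d.proj (Finset.subset_union_right.trans h.dom_eq.ge))) := by
  ext m
  rw [indep_apply h.cod_eq (Kernel.agree h.compat _ _ d), h.run_eq]

/-- The parallel composition `f ⊕ g`. -/
def Kernel.par (f g : Kernel V) (h : f.dom ∩ g.dom = f.cod ∩ g.cod) : Kernel V where
  dom := f.dom ∪ g.dom
  cod := f.cod ∪ g.cod
  dom_sub := Finset.union_subset_union f.dom_sub g.dom_sub
  run d := indep subset_rfl (f.run (d.proj Finset.subset_union_left))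
    (g.run (d.proj Finset.subset_union_right))
  preserves d := by
    rw [marg_indep, ← indep_marg f.dom_sub g.dom_sub subset_rfl (Kernel.agree h _ _ d),
      f.preserves, g.preserves, indep_pure, PMF.pure_map]
    exact congrArg PMF.pure (Mem.merge_self rfl d)

theorem Kernel.isPar_par (f g : Kernel V) (h : f.dom ∩ g.dom = f.cod ∩ g.cod) :
    IsPar f g (f.par g h) where
  compat := h
  dom_eq := rfl
  cod_eq := rfl
  run_eq d m := indep_apply rfl (Kernel.agree h _ _ d) m

/-- The parallel composition `f ⊕ unit R`. -/
def Kernel.parUnit (f : Kernel V) (R : Finset V) (h : f.dom ∩ R = f.cod ∩ R) : Kernel V where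
  dom := f.dom ∪ R
  cod := f.cod ∪ R
  dom_sub := Finset.union_subset_union f.dom_sub subset_rfl
  run d := (f.run (d.proj Finset.subset_union_left)).map fun a =>
    Mem.merge subset_rfl a (d.proj Finset.subset_union_right)
  preserves d := (indep_pure (B := R) subset_rfl _ _).symm ▸
    (f.par (Kernel.unit R) h).preserves d

theorem Kernel.isPar_parUnit (f : Kernel V) (R : Finset V) (h : f.dom ∩ R = f.cod ∩ R) :
    IsPar f (Kernel.unit R) (f.parUnit R h) where
  compat := h
  dom_eq := rfl
  cod_eq := rfl
  run_eq d m := (congrFun (congrArg _ (indep_pure _ _ _)) m).symm.trans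
    ((f.isPar_par (Kernel.unit R) h).run_eq d m)

/-- The Kleisli composition `f ⊙ g`. -/
def Kernel.seq (f g : Kernel V) (h : f.cod = g.dom) : Kernel V where
  dom := f.dom
  cod := g.cod
  dom_sub := f.dom_sub.trans (h.le.trans g.dom_sub)
  run d := (f.run d).bind fun m => g.run (m.proj h.ge)
  preserves d := by
    refine map_eq_pure fun a ha => ?_
    obtain ⟨m, hm, ha⟩ := (PMF.mem_support_bind_iff _ _ _).1 ha
    rw [← f.proj_of_mem_support hm]
    funext x
    exact congrFun (g.proj_of_mem_support ha) ⟨x.1, h.le (f.dom_sub x.2)⟩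

theorem Kernel.isSeq_seq (f g : Kernel V) (h : f.cod = g.dom) : IsSeq f g (f.seq g h) where
  compat := h
  dom_eq := rfl
  cod_eq := rfl
  run_eq _ := marg_self _ _

theorem IsSeq.marg_run {f g k : Kernel V} (h : IsSeq f g k) {S : Finset V} (hg : S ⊆ g.cod)
    (hk : S ⊆ k.cod) (d : Mem k.dom) :
    marg hk (k.run d) = (f.run (d.proj h.dom_eq.ge)).bind fun m =>
      marg hg (g.run (m.proj h.compat.ge)) := by
  rw [← marg_bind, ← h.run_eq, marg_marg]

/-- `f` is obtained from `g` by marginalization to variables outside of which the input of `g` is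
irrelevant. This is an equivalent form of `f ⊑ g`. -/
structure IsMarg (f g : Kernel V) : Prop where
  dom_sub : f.dom ⊆ g.dom
  cod_sub : f.cod ⊆ g.cod
  inter_sub : f.cod ∩ g.dom ⊆ f.dom
  marg_run : ∀ d : Mem g.dom, marg cod_sub (g.run d) = f.run (d.proj dom_sub)

/-! ### The order ⊑ as marginalization. -/

theorem IsMarg.refl (f : Kernel V) : IsMarg f f :=
  ⟨subset_rfl, subset_rfl, Finset.inter_subset_right, fun _ => marg_self _ _⟩

theorem IsMarg.trans {f g h : Kernel V} (hfg : IsMarg f g) (hgh : IsMarg g h) : IsMarg f h where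
  dom_sub := hfg.dom_sub.trans hgh.dom_sub
  cod_sub := hfg.cod_sub.trans hgh.cod_sub
  inter_sub x hx := by
    have h := Finset.mem_inter.1 hx
    exact hfg.inter_sub (Finset.mem_inter.2 ⟨h.1,
      hgh.inter_sub (Finset.mem_inter.2 ⟨hfg.cod_sub h.1, h.2⟩)⟩)
  marg_run d := by
    rw [← marg_marg hgh.cod_sub hfg.cod_sub, hgh.marg_run, hfg.marg_run]
    rfl

/-- Two kernels below a common one are comparable as soon as their ranges are. This lets persistence
move an assertion between two restrictions of the same state. -/
theorem IsMarg.of_isMarg {f g h : Kernel V} (hf : IsMarg f h) (hg : IsMarg g h)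
    (hfg : f.cod ⊆ g.cod) : IsMarg f g where
  dom_sub x hx := hg.inter_sub (Finset.mem_inter.2 ⟨hfg (f.dom_sub hx), hf.dom_sub hx⟩)
  cod_sub := hfg
  inter_sub := (Finset.inter_subset_inter_left hg.dom_sub).trans hf.inter_sub
  marg_run d := by
    -- An input of g is extended arbitrarily to an input of h, since the marginals of h do not see
    -- the added values.
    have h1 : d = (d.extend h.dom).proj hg.dom_sub := (Mem.proj_extend _ _).symm
    rw [h1, ← hg.marg_run, marg_marg, hf.marg_run]
    rfl

theorem IsPar.isMarg_left {f g k : Kernel V} (h : IsPar f g k) : IsMarg f k where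
  dom_sub := Finset.subset_union_left.trans h.dom_eq.ge
  cod_sub := Finset.subset_union_left.trans h.cod_eq.ge
  inter_sub x hx := by
    obtain ⟨h1, h2⟩ := Finset.mem_inter.1 hx
    rw [h.dom_eq] at h2
    rcases Finset.mem_union.1 h2 with h2 | h2
    · exact h2
    · exact (Finset.mem_inter.1 (h.compat.ge (Finset.mem_inter.2 ⟨h1, g.dom_sub h2⟩))).1
  marg_run d := by
    rw [h.run_eq_indep, marg_indep, indep_left _ subset_rfl, marg_self]

theorem IsPar.isMarg_right {f g k : Kernel V} (h : IsPar f g k) : IsMarg g k where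
  dom_sub := Finset.subset_union_right.trans h.dom_eq.ge
  cod_sub := Finset.subset_union_right.trans h.cod_eq.ge
  inter_sub x hx := by
    obtain ⟨h1, h2⟩ := Finset.mem_inter.1 hx
    rw [h.dom_eq] at h2
    rcases Finset.mem_union.1 h2 with h2 | h2
    · exact (Finset.mem_inter.1 (h.compat.ge (Finset.mem_inter.2 ⟨f.dom_sub h2, h1⟩))).2
    · exact h2
  marg_run d := by
    rw [h.run_eq_indep, marg_indep,
      indep_right _ subset_rfl (Kernel.agree h.compat _ _ d), marg_self]

/-- The second kernel copies its input, so forgetting its new variables leaves the output of f. -/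
theorem IsSeq.isMarg_left {f g k : Kernel V} (h : IsSeq f g k) : IsMarg f k where
  dom_sub := h.dom_eq.ge
  cod_sub := h.compat.le.trans (g.dom_sub.trans h.cod_eq.ge)
  inter_sub := Finset.inter_subset_right.trans h.dom_eq.le
  marg_run d := by
    rw [h.marg_run (h.compat.le.trans g.dom_sub)]
    have : ∀ m : Mem f.cod, marg (h.compat.le.trans g.dom_sub) (g.run (m.proj h.compat.ge)) =
        PMF.pure m := fun m => by
      rw [← marg_marg g.dom_sub h.compat.le, g.preserves, marg_pure]
      rfl
    simp only [this]
    exact PMF.bind_pure _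

theorem Kernel.Le.isMarg {f g : Kernel V} (h : f.Le g) : IsMarg f g := by
  obtain ⟨R, k, l, hk, hl⟩ := h
  exact hk.isMarg_left.trans hl.isMarg_left

open Classical in
/-- The conditional distributions of the outputs of `g` given the values of the variables in
`S`. -/
def Kernel.disintegrate (g : Kernel V) (S : Finset V) (hd : g.dom ⊆ S) (hc : S ⊆ g.cod) :
    Kernel V where
  dom := S
  cod := g.cod
  dom_sub := hc
  run m := if h : ∃ a ∈ {a : Mem g.cod | a.proj hc = m}, a ∈ (g.run (m.proj hd)).support then
      (g.run (m.proj hd)).filter {a | a.proj hc = m} h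
    -- Inputs of probability zero still need an output that preserves them; any extension would do.
    else PMF.pure (m.extend g.cod)
  preserves m := by
    split_ifs with h
    · refine map_eq_pure fun a ha => ?_
      rw [PMF.support_filter] at ha
      exact ha.1
    · rw [marg_pure, Mem.proj_extend]

/-- The disintegration recomputes the input of g from m. Almost every m drawn from g on input d
projects back to d, so the family of conditional laws of `g.run d` may be used instead. -/
theorem Kernel.marg_bind_disintegrate (g : Kernel V) (S : Finset V) (hd : g.dom ⊆ S)
    (hc : S ⊆ g.cod) (d : Mem g.dom) :
    ((marg hc (g.run d)).bind fun m => (g.disintegrate S hd hc).run m) = g.run d := by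
  classical
  set κ : Mem S → PMF (Mem g.cod) := fun m =>
    if h : ∃ a ∈ {a : Mem g.cod | a.proj hc = m}, a ∈ (g.run d).support then
      (g.run d).filter {a | a.proj hc = m} h
    else PMF.pure (m.extend g.cod) with hκ
  have := bind_map_eq_self (g.run d) (Mem.proj hc) κ fun b h => dif_pos h
  refine Eq.trans (bind_congr_support _ fun m hm => ?_) this
  unfold marg at hm
  rw [PMF.support_map] at hm
  obtain ⟨a, ha, rfl⟩ := hm
  have h : (a.proj hc).proj hd = d := g.proj_of_mem_support ha
  simp only [Kernel.disintegrate, hκ, h]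

/-- Variables of T outside S are inputs of g, hence almost surely carry their values in d. -/
theorem Kernel.run_eq_merge (g : Kernel V) {S T : Finset V} (hT : T ⊆ S ∪ g.dom)
    (hS : S ⊆ g.cod) (hTg : T ⊆ g.cod) (d : Mem g.dom) :
    marg hTg (g.run d) = (marg hS (g.run d)).map fun a => Mem.merge hT a d := by
  unfold marg
  rw [PMF.map_comp]
  refine map_congr_support _ fun a ha => ?_
  rw [← g.proj_of_mem_support ha]
  have := Mem.merge_proj hS g.dom_sub hT (m := a) (m' := a) fun _ _ _ => rfl
  refine Eq.trans ?_ this.symm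
  exact (Mem.merge_left _ hTg a a).symm

theorem Kernel.inter_eq_of_subset {f : Kernel V} {R : Finset V} (h : f.cod ∩ R ⊆ f.dom) :
    f.dom ∩ R = f.cod ∩ R :=
  (Finset.inter_subset_inter_right f.dom_sub).antisymm
    (Finset.subset_inter h Finset.inter_subset_right)

/-- Adding inputs of `g` to `f`, when `f ⊑ g`, gives a kernel below `g`. -/
theorem IsMarg.parUnit {f g : Kernel V} (h : IsMarg f g) {R : Finset V} (hR : R ⊆ g.dom)
    (hc : f.dom ∩ R = f.cod ∩ R) : IsMarg (f.parUnit R hc) g where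
  dom_sub := Finset.union_subset h.dom_sub hR
  cod_sub := Finset.union_subset h.cod_sub (hR.trans g.dom_sub)
  inter_sub := by
    change (f.cod ∪ R) ∩ g.dom ⊆ f.dom ∪ R
    rw [Finset.union_inter_distrib_right]
    exact Finset.union_subset_union h.inter_sub Finset.inter_subset_left
  marg_run d := by
    refine (g.run_eq_merge (Finset.union_subset_union subset_rfl hR) h.cod_sub _ d).trans ?_
    rw [h.marg_run]
    rfl

/-- Take R to be the whole domain of g: f ⊕ unit R is then a marginal of g containing all its
inputs, and the conditional law of g given this marginal is the required kernel. -/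
theorem IsMarg.le {f g : Kernel V} (h : IsMarg f g) : f.Le g := by
  have hc := Kernel.inter_eq_of_subset h.inter_sub
  have hk := h.parUnit subset_rfl hc
  have hd : g.dom ⊆ f.cod ∪ g.dom := Finset.subset_union_right
  refine ⟨g.dom, f.parUnit g.dom hc, g.disintegrate _ hd hk.cod_sub,
    f.isPar_parUnit _ hc, rfl, ?_, rfl, fun d => ?_⟩
  · exact Finset.subset_union_right.antisymm hk.dom_sub
  · refine (marg_self _ _).trans ((g.marg_bind_disintegrate _ hd hk.cod_sub d).symm.trans ?_)
    exact congrArg (PMF.bind · _) (hk.marg_run d)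

/-- The marginalization of a kernel to the variables in `S`. -/
def Kernel.restrict (f : Kernel V) (S : Finset V) (hd : f.dom ⊆ S) (hc : S ⊆ f.cod) :
    Kernel V where
  dom := f.dom
  cod := S
  dom_sub := hd
  run d := marg hc (f.run d)
  preserves d := by rw [marg_marg, f.preserves]

theorem Kernel.isMarg_restrict (f : Kernel V) (S : Finset V) (hd : f.dom ⊆ S)
    (hc : S ⊆ f.cod) : IsMarg (f.restrict S hd hc) f :=
  ⟨subset_rfl, hc, Finset.inter_subset_right, fun _ => rfl⟩

/-! ### Compatibility of ⊕ and ⊙ with the order. -/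

theorem IsMarg.inter_eq {f g f' g' : Kernel V} (hf : IsMarg f' f) (hg : IsMarg g' g)
    (h : f.dom ∩ g.dom = f.cod ∩ g.cod) : f'.dom ∩ g'.dom = f'.cod ∩ g'.cod := by
  refine (Finset.inter_subset_inter f'.dom_sub g'.dom_sub).antisymm fun x hx => ?_
  obtain ⟨h1, h2⟩ := Finset.mem_inter.1 hx
  obtain ⟨h3, h4⟩ := Finset.mem_inter.1
    (h.ge (Finset.mem_inter.2 ⟨hf.cod_sub h1, hg.cod_sub h2⟩))
  exact Finset.mem_inter.2 ⟨hf.inter_sub (Finset.mem_inter.2 ⟨h1, h3⟩),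
    hg.inter_sub (Finset.mem_inter.2 ⟨h2, h4⟩)⟩

theorem IsPar.isMarg {f g k f' g' k' : Kernel V} (h : IsPar f g k) (h' : IsPar f' g' k')
    (hf : IsMarg f' f) (hg : IsMarg g' g) : IsMarg k' k where
  dom_sub := h'.dom_eq.le.trans
    ((Finset.union_subset_union hf.dom_sub hg.dom_sub).trans h.dom_eq.ge)
  cod_sub := h'.cod_eq.le.trans
    ((Finset.union_subset_union hf.cod_sub hg.cod_sub).trans h.cod_eq.ge)
  inter_sub x hx := by
    obtain ⟨h1, h2⟩ := Finset.mem_inter.1 hx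
    rw [h'.cod_eq] at h1
    rw [h.dom_eq] at h2
    rw [h'.dom_eq]
    have hc := h.compat
    rcases Finset.mem_union.1 h1 with h1 | h1
    · have : x ∈ f.dom := by
        rcases Finset.mem_union.1 h2 with h2 | h2
        · exact h2
        · exact (Finset.mem_inter.1 (hc.ge (Finset.mem_inter.2
            ⟨hf.cod_sub h1, g.dom_sub h2⟩))).1
      exact Finset.mem_union_left _ (hf.inter_sub (Finset.mem_inter.2 ⟨h1, this⟩))
    · have : x ∈ g.dom := by
        rcases Finset.mem_union.1 h2 with h2 | h2
        · exact (Finset.mem_inter.1 (hc.ge (Finset.mem_inter.2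
            ⟨f.dom_sub h2, hg.cod_sub h1⟩))).2
        · exact h2
      exact Finset.mem_union_right _ (hg.inter_sub (Finset.mem_inter.2 ⟨h1, this⟩))
  marg_run d := by
    rw [h.run_eq_indep, h'.run_eq_indep, marg_indep,
      ← indep_marg hf.cod_sub hg.cod_sub h'.cod_eq.le (Kernel.agree h.compat _ _ d),
      hf.marg_run, hg.marg_run]
    rfl

theorem IsSeq.isMarg {f g k f' g' k' : Kernel V} (h : IsSeq f g k) (h' : IsSeq f' g' k')
    (hf : IsMarg f' f) (hg : IsMarg g' g) : IsMarg k' k where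
  dom_sub := h'.dom_eq.le.trans (hf.dom_sub.trans h.dom_eq.ge)
  cod_sub := h'.cod_eq.le.trans (hg.cod_sub.trans h.cod_eq.ge)
  inter_sub x hx := by
    obtain ⟨h1, h2⟩ := Finset.mem_inter.1 hx
    rw [h'.cod_eq] at h1
    rw [h.dom_eq] at h2
    rw [h'.dom_eq]
    refine hf.inter_sub (Finset.mem_inter.2 ⟨?_, h2⟩)
    rw [h'.compat]
    refine hg.inter_sub (Finset.mem_inter.2 ⟨h1, ?_⟩)
    rw [← h.compat]
    exact f.dom_sub h2
  marg_run d := by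
    have e1 : k'.cod ⊆ g.cod := h'.cod_eq.le.trans hg.cod_sub
    rw [h.marg_run e1]
    have e2 := h'.marg_run h'.cod_eq.le subset_rfl
      (d.proj (h'.dom_eq.le.trans (hf.dom_sub.trans h.dom_eq.ge)))
    rw [marg_self] at e2
    rw [e2]
    have e3 : ∀ m : Mem g.dom, marg e1 (g.run m) =
        marg h'.cod_eq.le (g'.run (m.proj hg.dom_sub)) := fun m => by
      rw [← hg.marg_run, marg_marg]
    simp only [e3]
    have e4 := hf.marg_run (d.proj h.dom_eq.ge)
    change _ = PMF.bind (f'.run ((d.proj h.dom_eq.ge).proj hf.dom_sub)) _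
    rw [← e4, bind_marg]
    rfl

theorem IsPar.run_eq_map {f k : Kernel V} {R : Finset V} (h : IsPar f (Kernel.unit R) k)
    (d : Mem k.dom) : k.run d =
      (f.run (d.proj (Finset.subset_union_left.trans h.dom_eq.ge))).map fun a =>
        Mem.merge (B := R) h.cod_eq.le a
          (d.proj (Finset.subset_union_right.trans h.dom_eq.ge)) :=
  (h.run_eq_indep d).trans (indep_pure _ _ _)

/-- If `f ⊑ g` and `f` is a Kleisli composition, then so is `g`, of larger kernels. -/
theorem IsSeq.exists_of_isMarg {f g k k' : Kernel V} (h : IsSeq f g k) (hk : IsMarg k k') :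
    ∃ f' g', IsSeq f' g' k' ∧ IsMarg f f' ∧ IsMarg g g' := by
  obtain ⟨R, p, l, hp, hl⟩ := hk.le
  have hR : k.dom ∩ R = k.cod ∩ R := hp.compat
  -- R meets the range of k only in the domain of k, which f passes on to g.
  have hRg : g.dom ∩ R = g.cod ∩ R := by
    refine Kernel.inter_eq_of_subset ?_
    rw [← h.cod_eq, ← hR, h.dom_eq, ← h.compat]
    exact Finset.inter_subset_left.trans f.dom_sub
  have hRf : f.dom ∩ R = f.cod ∩ R := by
    refine Kernel.inter_eq_of_subset ?_
    rw [h.compat, hRg, ← h.cod_eq, ← hR, h.dom_eq]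
    exact Finset.inter_subset_left
  have hgl : (g.parUnit R hRg).cod = l.dom := by
    rw [← hl.compat, hp.cod_eq, h.cod_eq]
    rfl
  -- Reassociation: ((f ⊙ g) ⊕ unit R) ⊙ l = (f ⊕ unit R) ⊙ ((g ⊕ unit R) ⊙ l).
  refine ⟨f.parUnit R hRf, (g.parUnit R hRg).seq l hgl, ?_, ?_, ?_⟩
  · refine ⟨congrArg (· ∪ R) h.compat, ?_, hl.cod_eq, fun d => ?_⟩
    · rw [hl.dom_eq, hp.dom_eq, h.dom_eq]
      rfl
    · have e1 := hl.marg_run subset_rfl hl.cod_eq.ge d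
      simp only [marg_self] at e1
      refine e1.trans ?_
      have e2 := h.marg_run h.cod_eq.le subset_rfl
      simp only [marg_self] at e2
      rw [hp.run_eq_map, e2, PMF.bind_map, PMF.bind_bind]
      refine Eq.trans ?_ (PMF.bind_map _ _ _).symm
      refine bind_congr_support _ fun a ha => ?_
      have hRk : R ⊆ k'.dom := (Finset.subset_union_right.trans hp.dom_eq.ge).trans hl.dom_eq.ge
      have hfk : f.dom ⊆ k'.dom := (h.dom_eq.ge.trans hk.dom_sub)
      have har : Mem.Agree a (d.proj hRk) :=
        Kernel.agree (g := Kernel.unit R) hRf hfk hRk d a ha _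
          ((PMF.mem_support_pure_iff _ _).2 rfl)
      refine (bind_marg _ _ _).trans (Eq.trans ?_ (PMF.bind_map _ _ _).symm)
      have e3 : (Mem.merge subset_rfl a (d.proj hRk)).proj
            (h.compat.ge.trans Finset.subset_union_left : g.dom ⊆ f.cod ∪ R) =
          a.proj h.compat.ge := Mem.merge_left (C := g.dom)
            (h.compat.ge.trans Finset.subset_union_left) h.compat.ge _ _
      have e4 : (Mem.merge subset_rfl a (d.proj hRk)).proj
            (Finset.subset_union_right : R ⊆ f.cod ∪ R) = d.proj hRk :=
        Mem.merge_right (C := R) Finset.subset_union_right subset_rfl har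
      refine Eq.trans ?_ (congrArg (fun z => PMF.bind (g.run z) _) e3).symm
      refine bind_congr_support _ fun b hb => ?_
      have hbr : Mem.Agree b (d.proj hRk) := by
        intro x hx1 hx2
        have hx : x ∈ g.dom := (Finset.mem_inter.1
          (hRg.ge (Finset.mem_inter.2 ⟨hx1, hx2⟩))).1
        exact (congrFun (g.proj_of_mem_support hb) ⟨x, hx⟩).trans (har x (h.compat.ge hx) hx2)
      have e5 : ∀ (S : Finset V) (hS : S = k.cod ∪ R) (hS' : S = g.cod ∪ R),
          Mem.merge hS.le (b.proj h.cod_eq.le) (d.proj hRk) =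
          Mem.merge hS'.le b (d.proj hRk) := fun S hS hS' =>
        Mem.merge_proj h.cod_eq.le subset_rfl hS.le hbr
      refine congrArg l.run ((e5 l.dom (hl.compat.symm.trans hp.cod_eq) hgl.symm).trans ?_)
      exact congrArg (fun z => Mem.merge (C := l.dom) (B := R) hgl.ge b z) e4.symm
  -- Nothing follows f ⊕ unit R here, so the second kernel in the definition of ⊑ is a unit.
  · refine Kernel.Le.isMarg ⟨R, _, Kernel.unit _, f.isPar_parUnit _ hRf, rfl, rfl, rfl,
      fun d => ?_⟩
    exact (marg_self _ _).trans (PMF.bind_pure _).symm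
  · exact Kernel.Le.isMarg ⟨R, _, l, g.isPar_parUnit _ hRg, Kernel.isSeq_seq _ _ hgl⟩

end Kernels

/-! ### Formulas on distributions -/

section RangeFormulas

variable {V : Type*} [DecidableEq V]

/-- The part of a memory on A ∩ B is almost surely m, so its part on A \ B identifies it on the
support. -/
theorem marg_sdiff_mul_pure {A B : Finset V} {μ : PMF (Mem A)} {m : Mem (A ∩ B)}
    (h : marg Finset.inter_subset_left μ = PMF.pure m) (a : Mem A) :
    marg (Finset.sdiff_subset : A \ B ⊆ A) μ (a.proj Finset.sdiff_subset) *
      PMF.pure m (a.proj Finset.inter_subset_left) = μ a := by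
  classical
  by_cases ha : a.proj Finset.inter_subset_left = m
  · rw [PMF.pure_apply, if_pos ha, mul_one]
    unfold marg
    rw [PMF.map_apply, tsum_eq_single a]
    · exact if_pos rfl
    · intro a' ha'
      by_cases hμ : μ a' = 0
      · simp [hμ]
      refine if_neg fun h1 => ha' ?_
      have h2 : a'.proj Finset.inter_subset_left = m := eq_of_map_eq_pure h hμ
      funext x
      by_cases hx : x.1 ∈ B
      · exact congrFun (h2.trans ha.symm) ⟨x.1, Finset.mem_inter.2 ⟨x.2, hx⟩⟩
      · exact (congrFun h1 ⟨x.1, Finset.mem_sdiff.2 ⟨x.2, hx⟩⟩).symm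
  · rw [PMF.pure_apply, if_neg ha, mul_zero]
    by_contra hμ
    exact ha (eq_of_map_eq_pure h (Ne.symm hμ))

theorem marg_sdiff_mul_pure' {A B : Finset V} {μ : PMF (Mem B)} {m : Mem (A ∩ B)}
    (h : marg Finset.inter_subset_right μ = PMF.pure m) (b : Mem B) :
    PMF.pure m (b.proj Finset.inter_subset_right) *
      marg (Finset.sdiff_subset : B \ A ⊆ B) μ (b.proj Finset.sdiff_subset) = μ b := by
  classical
  by_cases hb : b.proj Finset.inter_subset_right = m
  · rw [PMF.pure_apply, if_pos hb, one_mul]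
    unfold marg
    rw [PMF.map_apply, tsum_eq_single b]
    · exact if_pos rfl
    · intro b' hb'
      by_cases hμ : μ b' = 0
      · simp [hμ]
      refine if_neg fun h1 => hb' ?_
      have h2 : b'.proj Finset.inter_subset_right = m := eq_of_map_eq_pure h hμ
      funext x
      by_cases hx : x.1 ∈ A
      · exact congrFun (h2.trans hb.symm) ⟨x.1, Finset.mem_inter.2 ⟨hx, x.2⟩⟩
      · exact (congrFun h1 ⟨x.1, Finset.mem_sdiff.2 ⟨x.2, hx⟩⟩).symm
  · rw [PMF.pure_apply, if_neg hb, zero_mul]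
    by_contra hμ
    exact hb (eq_of_map_eq_pure h (Ne.symm hμ))

/-- This trades the three-factor formula for merging independent memories, which behaves well under
marginals. -/
theorem isDistPar_iff {A B C : Finset V} {μ₁ : PMF (Mem A)} {μ₂ : PMF (Mem B)}
    {ν : PMF (Mem C)} :
    IsDistPar μ₁ μ₂ ν ↔ Agree μ₁ μ₂ ∧ ∃ hC : C = A ∪ B, ν = indep hC.le μ₁ μ₂ := by
  classical
  have key : ∀ (hC : C = A ∪ B) (m : Mem (A ∩ B)),
      marg Finset.inter_subset_left μ₁ = PMF.pure m →
      marg Finset.inter_subset_right μ₂ = PMF.pure m → Agree μ₁ μ₂ → ∀ r : Mem C,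
      marg (Finset.sdiff_subset : A \ B ⊆ A) μ₁
            (r.proj (Finset.sdiff_subset.trans (Finset.subset_union_left.trans hC.ge))) *
          PMF.pure m
            (r.proj (Finset.inter_subset_left.trans (Finset.subset_union_left.trans hC.ge))) *
          marg (Finset.sdiff_subset : B \ A ⊆ B) μ₂
            (r.proj (Finset.sdiff_subset.trans (Finset.subset_union_right.trans hC.ge))) =
        indep hC.le μ₁ μ₂ r := by
    intro hC m h1 h2 ha r
    rw [indep_apply hC ha,
      ← marg_sdiff_mul_pure h1 (r.proj (Finset.subset_union_left.trans hC.ge)),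
      ← marg_sdiff_mul_pure' h2 (r.proj (Finset.subset_union_right.trans hC.ge))]
    -- Each of the two distributions contributes the factor of the point mass; being 0 or 1, it may
    -- be counted twice.
    have h3 : ∀ x : ℝ≥0∞, x = 1 ∨ x = 0 → ∀ y z, y * x * z = y * x * (x * z) := by
      rintro x (rfl | rfl) y z <;> simp
    refine h3 _ ?_ _ _
    rw [PMF.pure_apply]
    split_ifs <;> simp
  constructor
  · rintro ⟨hC, m, h1, h2, h3⟩
    have ha : Agree μ₁ μ₂ := fun a ha b hb x hxa hxb =>
      congrFun ((eq_of_map_eq_pure h1 ha).trans (eq_of_map_eq_pure h2 hb).symm)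
        ⟨x, Finset.mem_inter.2 ⟨hxa, hxb⟩⟩
    refine ⟨ha, hC, ?_⟩
    ext r
    rw [h3 r, key hC m h1 h2 ha r]
  · rintro ⟨ha, hC, rfl⟩
    obtain ⟨a₀, ha₀⟩ := exists_mem_support μ₁
    obtain ⟨b₀, hb₀⟩ := exists_mem_support μ₂
    have h2 : marg Finset.inter_subset_right μ₂ =
        PMF.pure (a₀.proj (Finset.inter_subset_left : A ∩ B ⊆ A)) :=
      map_eq_pure fun b hb => funext fun x =>
        (ha a₀ ha₀ b hb x.1 (Finset.mem_inter.1 x.2).1 (Finset.mem_inter.1 x.2).2).symm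
    have h1 : marg Finset.inter_subset_left μ₁ =
        PMF.pure (a₀.proj (Finset.inter_subset_left : A ∩ B ⊆ A)) :=
      map_eq_pure fun a h => funext fun x =>
        (ha a h b₀ hb₀ x.1 (Finset.mem_inter.1 x.2).1 (Finset.mem_inter.1 x.2).2).trans
          (ha a₀ ha₀ b₀ hb₀ x.1 (Finset.mem_inter.1 x.2).1 (Finset.mem_inter.1 x.2).2).symm
    exact ⟨hC, _, h1, h2, fun r => (key hC _ h1 h2 ha r).symm⟩

theorem prob_marg_eq_one_iff {S T : Finset V} (h : T ⊆ S) (μ : PMF (Mem S)) {x : V} {e : Exp V}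
    (he : {x} ∪ e.fv ⊆ T) :
    prob (marg h μ) {m | m.get x = e.eval m} = 1 ↔ prob μ {m | m.get x = e.eval m} = 1 := by
  have key : ∀ m : Mem S, (m.proj h).get x = e.eval (m.proj h) ↔ m.get x = e.eval m := by
    intro m
    rw [Mem.get_proj h m (he (Finset.mem_union_left _ (Finset.mem_singleton_self x))),
      Exp.eval_proj h m e (Finset.subset_union_right.trans he)]
  rw [prob_eq_one_iff, prob_eq_one_iff]
  unfold marg
  simp only [PMF.support_map, Set.mem_image, forall_exists_index, and_imp,
    forall_apply_eq_imp_iff₂, Set.mem_ofPred_eq, key]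

theorem RForm.Sat.fv_subset {r : RForm V} :
    ∀ {S : Finset V} {μ : PMF (Mem S)}, r.Sat μ → r.fv ⊆ S := by
  induction r with
  | mem T => exact fun h => h
  | dist x d => exact fun ⟨hx, hd, _⟩ => Finset.union_subset (Finset.singleton_subset_iff.2 hx) hd
  | eq x e => exact fun h => h.1
  | top => exact fun _ => Finset.empty_subset _
  | bot => exact fun h => h.elim
  | and p q hp hq => exact fun h => Finset.union_subset (hp h.1) (hq h.2)
  | sep p q hp hq =>
    rintro S μ ⟨A, B, C, μ₁, μ₂, ν, ⟨hC, _⟩, ⟨hCS, _⟩, h1, h2⟩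
    exact (Finset.union_subset_union (hp h1) (hq h2)).trans (hC.ge.trans hCS)

theorem RForm.sat_of_sat_marg {r : RForm V} : ∀ {S T : Finset V} (h : T ⊆ S) {μ : PMF (Mem S)},
    r.Sat (marg h μ) → r.Sat μ := by
  induction r with
  | mem U => exact fun h _ hU => Finset.Subset.trans hU h
  | dist x d =>
    rintro S T h μ ⟨hx, hd, m, hm, hl⟩
    refine ⟨h hx, hd.trans h, m, by rwa [marg_marg] at hm, ?_⟩
    unfold marg at hl
    rwa [PMF.map_comp] at hl
  | eq x e => exact fun h μ hs => ⟨hs.1.trans h, (prob_marg_eq_one_iff h μ hs.1).1 hs.2⟩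
  | top => exact fun _ _ h => h
  | bot => exact fun _ _ h => h
  | and p q hp hq => exact fun h _ hs => ⟨hp h hs.1, hq h hs.2⟩
  | sep p q hp hq =>
    rintro S T h μ ⟨A, B, C, μ₁, μ₂, ν, hpar, ⟨hC, hν⟩, h1, h2⟩
    exact ⟨A, B, C, μ₁, μ₂, ν, hpar, ⟨hC.trans h, by rwa [marg_marg] at hν⟩, h1, h2⟩

theorem RForm.Sat.marg_fv {r : RForm V} : ∀ {S : Finset V} {μ : PMF (Mem S)} (_ : r.Sat μ)
    (h : r.fv ⊆ S), r.Sat (marg h μ) := by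
  induction r with
  | mem U => exact fun _ _ => subset_rfl (a := U)
  | dist x d =>
    rintro S μ ⟨hx, hd, m, hm, hl⟩ h
    refine ⟨Finset.mem_union_left _ (Finset.mem_singleton_self x), Finset.subset_union_right, m,
      (marg_marg h Finset.subset_union_right μ).trans hm, ?_⟩
    unfold marg
    rwa [PMF.map_comp]
  | eq x e => exact fun hs h => ⟨subset_rfl, (prob_marg_eq_one_iff h _ subset_rfl).2 hs.2⟩
  | top => exact fun h _ => h
  | bot => exact fun h _ => h
  | and p q hp hq =>
    intro S μ hs h
    have h1 := hp hs.1 (Finset.subset_union_left.trans h)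
    have h2 := hq hs.2 (Finset.subset_union_right.trans h)
    rw [← marg_marg h Finset.subset_union_left] at h1
    rw [← marg_marg h Finset.subset_union_right] at h2
    exact ⟨sat_of_sat_marg _ h1, sat_of_sat_marg _ h2⟩
  | sep p q hp hq =>
    rintro S μ ⟨A, B, C, μ₁, μ₂, ν, hpar, ⟨hC, rfl⟩, h1, h2⟩ h
    obtain ⟨ha, rfl, hν⟩ := isDistPar_iff.1 hpar
    -- Both factors shrink to the variables of their own formulas; they still agree, and their
    -- product is exactly the marginal on all variables of the formula.
    refine ⟨_, _, _, _, _, marg h μ, isDistPar_iff.2 ⟨ha.marg (fv_subset h1) (fv_subset h2), rfl,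
      ?_⟩, ⟨subset_rfl, marg_self _ _⟩, hp h1 (fv_subset h1), hq h2 (fv_subset h2)⟩
    have h3 : p.fv ∪ q.fv ⊆ A ∪ B := Finset.union_subset_union (fv_subset h1) (fv_subset h2)
    refine (marg_marg hC h3 μ).symm.trans ?_
    rw [hν, marg_indep, indep_marg _ _ _ ha]
    rfl

theorem RForm.sat_marg_iff {r : RForm V} {S T : Finset V} (h : T ⊆ S) (hT : r.fv ⊆ T)
    {μ : PMF (Mem S)} : r.Sat (marg h μ) ↔ r.Sat μ := by
  refine ⟨sat_of_sat_marg h, fun hs => ?_⟩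
  have := hs.marg_fv (hT.trans h)
  rw [← marg_marg h hT] at this
  exact sat_of_sat_marg hT this

end RangeFormulas

/-! ### Assertions -/

section Assertions

variable {V : Type*} [DecidableEq V]

/-- Persistence is built into atoms and *; only ; needs an argument, namely that factorizations lift
along ⊑. -/
theorem Form.Sat.mono {P : Form V} : ∀ {f g : Kernel V}, P.Sat f → IsMarg f g → P.Sat g := by
  induction P with
  | atom S p r =>
    rintro f g ⟨f', hf, h⟩ hfg
    exact ⟨f', (hf.isMarg.trans hfg).le, h⟩
  | top => exact fun h _ => h
  | bot => exact fun h _ => h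
  | and P Q hP hQ => exact fun h hfg => ⟨hP h.1 hfg, hQ h.2 hfg⟩
  | or P Q hP hQ => exact fun h hfg => h.imp (hP · hfg) (hQ · hfg)
  | sep P Q hP hQ =>
    rintro f g ⟨f', h₁, h₂, hpar, hle, h⟩ hfg
    exact ⟨f', h₁, h₂, hpar, (hle.isMarg.trans hfg).le, h⟩
  | dep P Q hP hQ =>
    rintro f g ⟨h₁, h₂, hseq, h1, h2⟩ hfg
    obtain ⟨h₁', h₂', hseq', hm1, hm2⟩ := hseq.exists_of_isMarg hfg
    exact ⟨h₁', h₂', hseq', hP h1 hm1, hQ h2 hm2⟩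

/-- For atoms this needs a memory satisfying p_d: without one, the atom would put no constraint on
the range. -/
theorem Form.Sat.fvR_subset {P : Form V} :
    ∀ {f : Kernel V}, P.Sat f → P.RDIBI → P.fvR ⊆ f.cod := by
  induction P with
  | atom S p r =>
    rintro f ⟨f', hf, h⟩ ⟨hp, m, hm⟩
    obtain ⟨hS, hr⟩ := h m hm
    rw [Form.fvR, Finset.union_eq_left.2 hp]
    exact Finset.union_subset (hS.ge.trans (f'.dom_sub.trans hf.isMarg.cod_sub))
      (hr.fv_subset.trans hf.isMarg.cod_sub)
  | top => exact fun _ _ => Finset.empty_subset _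
  | bot => exact fun h _ => h.elim
  | and P Q hP hQ => exact fun h hr => Finset.union_subset (hP h.1 hr.1) (hQ h.2 hr.2.1)
  | or P Q hP hQ =>
    rintro f (h | h) hr
    · exact Finset.inter_subset_left.trans (hP h hr.1)
    · exact Finset.inter_subset_right.trans (hQ h hr.2)
  | sep P Q hP hQ =>
    rintro f ⟨f', g, h, hpar, hle, h1, h2⟩ hr
    exact (Finset.union_subset_union (hP h1 hr.1) (hQ h2 hr.2)).trans
      (hpar.cod_eq.ge.trans hle.isMarg.cod_sub)
  | dep P Q hP hQ =>
    rintro f ⟨g, h, hseq, h1, h2⟩ hr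
    refine (Finset.union_subset ((hP h1 hr.1).trans ?_) (hQ h2 hr.2.1)).trans hseq.cod_eq.ge
    exact hseq.compat.le.trans h.dom_sub

/-- A state satisfying an assertion of RDIBI is above a state that satisfies the assertion and
mentions only variables of the assertion. -/
theorem Form.Sat.exists_restriction {P : Form V} : ∀ {f : Kernel V}, P.Sat f → P.RDIBI →
    ∃ f', IsMarg f' f ∧ P.Sat f' ∧ f'.dom ⊆ P.fvD ∧ f'.cod ⊆ P.fv := by
  induction P with
  | atom S p r =>
    rintro f ⟨f', hf, h⟩ ⟨hp, m₀, hm₀⟩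
    obtain ⟨hS, hr⟩ := h m₀ hm₀
    have hd : f'.dom ⊆ S ∪ r.fv := hS.le.trans Finset.subset_union_left
    have hc : S ∪ r.fv ⊆ f'.cod := Finset.union_subset (hS.ge.trans f'.dom_sub) hr.fv_subset
    refine ⟨f'.restrict _ hd hc, (f'.isMarg_restrict _ hd hc).trans hf.isMarg,
      ⟨_, (IsMarg.refl _).le, fun m hm => ⟨hS, ?_⟩⟩, hS.le.trans Finset.subset_union_left,
      Finset.union_subset_union Finset.subset_union_left subset_rfl⟩
    obtain ⟨_, hr'⟩ := h m hm
    exact (RForm.sat_marg_iff hc Finset.subset_union_right).2 hr'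
  | top =>
    intro f _ _
    -- The unit on no variables lies below every state.
    refine ⟨Kernel.unit ∅, ⟨Finset.empty_subset _, Finset.empty_subset _,
      Finset.inter_subset_left, fun d => map_eq_pure fun a _ => ?_⟩, trivial, subset_rfl,
      subset_rfl⟩
    funext x
    exact absurd x.2 (Finset.notMem_empty x.1)
  | bot => exact fun h _ => h.elim
  | and P Q hP hQ =>
    rintro f ⟨h1, h2⟩ ⟨hr1, hr2, e1, e2, e3⟩
    obtain ⟨f₁, hm1, hs1, hd1, hc1⟩ := hP h1 hr1
    obtain ⟨f₂, hm2, hs2, hd2, hc2⟩ := hQ h2 hr2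
    -- The side condition on ∧ makes FV(Q) equal to FV_R(P), which the range of the first
    -- restriction covers; so the second restriction lies below the first.
    have hc : f₂.cod ⊆ f₁.cod :=
      hc2.trans (e3.ge.trans (e2.ge.trans (e1.ge.trans (hs1.fvR_subset hr1))))
    exact ⟨f₁, hm1, ⟨hs1, hs2.mono (hm2.of_isMarg hm1 hc)⟩, hd1.trans Finset.subset_union_left,
      hc1.trans Finset.subset_union_left⟩
  | or P Q hP hQ =>
    rintro f (h | h) hr
    · obtain ⟨f', hm, hs, hd, hc⟩ := hP h hr.1
      exact ⟨f', hm, Or.inl hs, hd.trans Finset.subset_union_left,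
        hc.trans Finset.subset_union_left⟩
    · obtain ⟨f', hm, hs, hd, hc⟩ := hQ h hr.2
      exact ⟨f', hm, Or.inr hs, hd.trans Finset.subset_union_right,
        hc.trans Finset.subset_union_right⟩
  | sep P Q hP hQ =>
    rintro f ⟨k, g, h, hpar, hle, h1, h2⟩ hr
    obtain ⟨g', hm1, hs1, hd1, hc1⟩ := hP h1 hr.1
    obtain ⟨h', hm2, hs2, hd2, hc2⟩ := hQ h2 hr.2
    have hp := g'.isPar_par h' (hm1.inter_eq hm2 hpar.compat)
    exact ⟨_, (hpar.isMarg hp hm1 hm2).trans hle.isMarg,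
      ⟨_, g', h', hp, (IsMarg.refl _).le, hs1, hs2⟩, Finset.union_subset_union hd1 hd2,
      Finset.union_subset_union hc1 hc2⟩
  | dep P Q hP hQ =>
    rintro f ⟨g, h, hseq, h1, h2⟩ ⟨hr1, hr2, hPQ⟩
    obtain ⟨g', hm1, hs1, hd1, hc1⟩ := hP h1 hr1
    obtain ⟨h', hm2, hs2, hd2, hc2⟩ := hQ h2 hr2
    -- The side condition on ; ensures that the first restriction still supplies every input of the
    -- second. Its surplus outputs are then passed along by a unit.
    have hdom : h'.dom ⊆ g'.cod := hd2.trans (hPQ.trans (hs1.fvR_subset hr1))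
    have hgd : g'.cod ⊆ h.dom := hm1.cod_sub.trans hseq.compat.le
    have hi : h'.dom ∩ g'.cod = h'.cod ∩ g'.cod := Kernel.inter_eq_of_subset
      ((Finset.inter_subset_inter_left hgd).trans hm2.inter_sub)
    have hm3 := hm2.parUnit hgd hi
    have hs3 : Q.Sat (h'.parUnit _ hi) :=
      hs2.mono (hm2.of_isMarg hm3 Finset.subset_union_left)
    have hq := g'.isSeq_seq (h'.parUnit _ hi) (Finset.union_eq_right.2 hdom).symm
    exact ⟨_, hseq.isMarg hq hm1 hm3, ⟨g', _, hq, hs1, hs3⟩, hd1.trans Finset.subset_union_left,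
      Finset.union_subset (hc2.trans Finset.subset_union_right)
        (hc1.trans Finset.subset_union_left)⟩

end Assertions

/-! ### Auxiliary facts about programs, kernels and derivations -/

section Auxiliary

variable {V : Type*} [DecidableEq V]

theorem Com.wv_subset_mv (c : Com V) : c.wv ⊆ c.mv := by
  induction c with
  | skip => exact subset_rfl
  | assn x e => exact Finset.sdiff_subset
  | samp x d => exact Finset.sdiff_subset
  | seq c c' ih ih' => exact Finset.union_subset_union ih (Finset.sdiff_subset.trans ih')
  | cond b c c' ih ih' =>
    exact Finset.sdiff_subset.trans (Finset.inter_subset_left.trans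
      (ih.trans Finset.subset_union_left))

/-- Such a κ factors through the projection to T. -/
theorem bind_congr_marg {β : Type*} {S T : Finset V} (h : T ⊆ S) {μ μ' : PMF (Mem S)}
    (hμ : marg h μ = marg h μ') {κ : Mem S → PMF β}
    (hκ : ∀ m m' : Mem S, m.proj h = m'.proj h → κ m = κ m') : μ.bind κ = μ'.bind κ := by
  have key : ∀ μ : PMF (Mem S), μ.bind κ = (marg h μ).bind fun a => κ (a.extend S) := by
    intro μ
    rw [bind_marg]
    congr 1
    funext m
    exact hκ _ _ (Mem.proj_extend h _).symm
  rw [key, key, hμ]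

theorem Kernel.isMarg_lift_marg {S T : Finset V} (h : T ⊆ S) (μ : PMF (Mem S)) :
    IsMarg (Kernel.lift (marg h μ)) (Kernel.lift μ) :=
  ⟨subset_rfl, h, Finset.inter_subset_right, fun _ => rfl⟩

theorem Form.Sat.rform_sat {r : RForm V} {S : Finset V} {μ : PMF (Mem S)}
    (h : (Form.atom ∅ .top r).Sat (Kernel.lift μ)) : r.Sat μ := by
  obtain ⟨f, hf, h⟩ := h
  have d : Mem (∅ : Finset V) := fun _ => false
  obtain ⟨_, hr⟩ := h d trivial
  have := hf.isMarg.marg_run d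
  exact RForm.sat_of_sat_marg hf.isMarg.cod_sub (this ▸ hr)

theorem Form.sat_atom_lift {r : RForm V} {S : Finset V} {μ : PMF (Mem S)} (h : r.Sat μ) :
    (Form.atom ∅ .top r).Sat (Kernel.lift μ) :=
  ⟨_, (IsMarg.refl _).le, fun _ _ => ⟨rfl, h⟩⟩

theorem Derivable.rdibi {P Q : Form V} {c : Com V} (h : Derivable P c Q) :
    P.RDIBI ∧ Q.RDIBI := by
  induction h with
  | assn hP hQ _ => exact ⟨hP, hQ⟩
  | samp hP hQ _ => exact ⟨hP, hQ⟩
  | skip hP => exact ⟨hP, hP⟩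
  | seqn _ _ ih ih' => exact ⟨ih.1, ih'.2⟩
  | dcond hP hQ _ _ _ _ => exact ⟨hP, hQ⟩
  | weak hP' hQ' _ _ _ _ => exact ⟨hP', hQ'⟩
  | frame hR _ _ _ _ ih => exact ⟨⟨ih.1, hR⟩, ⟨ih.2, hR⟩⟩

end Auxiliary

/-! ### Programs as Markov kernels -/

section Programs

variable {V : Type*} [Fintype V] [DecidableEq V]

/-- The output distribution of a command on a single input memory. -/
def Com.step : Com V → Mem (Finset.univ : Finset V) → PMF (Mem (Finset.univ : Finset V))
  | .skip, m => PMF.pure m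
  | .assn x e, m => PMF.pure (m.update x (e.eval m))
  | .samp x d, m => (d.eval (m.proj (Finset.subset_univ _))).bind fun v => PMF.pure (m.update x v)
  | .seq c c', m => (c.step m).bind c'.step
  | .cond b c c', m => if m.get b then c.step m else c'.step m

theorem Com.den_cond_eq_bind (b : V) (c c' : Com V) (μ : PMF (Mem (Finset.univ : Finset V))) :
    (Com.cond b c c').den μ = (μ.map fun m => m.get b).bind fun v =>
      if v then c.den (condOn μ {m | m.get b = true})
      else c'.den (condOn μ {m | m.get b = false}) :=
  convex_eq_bind _ _ _ (prob_eq_map μ (fun m => m.get b) true).symm _ _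

theorem Com.den_eq_bind (c : Com V) : ∀ μ : PMF (Mem (Finset.univ : Finset V)),
    c.den μ = μ.bind c.step := by
  induction c with
  | skip => exact fun μ => (PMF.bind_pure μ).symm
  | assn x e => exact fun μ => rfl
  | samp x d => exact fun μ => rfl
  | seq c c' ih ih' =>
    intro μ
    simp only [Com.den, Com.step]
    rw [ih, ih', PMF.bind_bind]
  | cond b c c' ih ih' =>
    intro μ
    rw [Com.den_cond_eq_bind]
    -- Total probability over the value of the guard, applied to the μ on the right-hand side.
    nth_rw 4 [← bind_map_condOn μ fun m => m.get b]
    rw [PMF.bind_bind]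
    refine bind_congr_support _ fun v hv => ?_
    have key := fun a ha => mem_of_mem_support_condOn (a := a) (exists_of_mem_support_map hv) ha
    cases v with
    | true =>
      rw [if_pos rfl, ih]
      exact bind_congr_support _ fun a ha => (if_pos (key a ha)).symm
    | false =>
      rw [if_neg Bool.false_ne_true, ih']
      refine bind_congr_support _ fun a ha => (if_neg ?_).symm
      rw [show a.get b = false from key a ha]
      exact Bool.false_ne_true

/-- A command does not change variables outside of `MV`. -/
theorem Com.get_of_mem_support_step (c : Com V) : ∀ {m m' : Mem (Finset.univ : Finset V)},
    m' ∈ (c.step m).support → ∀ x, x ∉ c.mv → m'.get x = m.get x := by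
  induction c with
  | skip =>
    intro m m' h x _
    rw [(PMF.mem_support_pure_iff _ _).1 h]
  | assn x e =>
    intro m m' h y hy
    rw [(PMF.mem_support_pure_iff _ _).1 h, Mem.get_update _ (Finset.mem_univ x),
      if_neg (fun h => hy (Finset.mem_singleton.2 h))]
  | samp x d =>
    intro m m' h y hy
    obtain ⟨v, _, h⟩ := (PMF.mem_support_bind_iff _ _ _).1 h
    rw [(PMF.mem_support_pure_iff _ _).1 h, Mem.get_update _ (Finset.mem_univ x),
      if_neg (fun h => hy (Finset.mem_singleton.2 h))]
  | seq c c' ih ih' =>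
    intro m m' h x hx
    obtain ⟨m₁, h₁, h⟩ := (PMF.mem_support_bind_iff _ _ _).1 h
    rw [ih' h x fun h => hx (Finset.mem_union_right _ h),
      ih h₁ x fun h => hx (Finset.mem_union_left _ h)]
  | cond b c c' ih ih' =>
    intro m m' h x hx
    unfold Com.step at h
    split_ifs at h
    · exact ih h x fun h => hx (Finset.mem_union_left _ h)
    · exact ih' h x fun h => hx (Finset.mem_union_right _ h)

theorem Mem.update_proj_congr {A W : Finset V} {m m' : Mem (Finset.univ : Finset V)} {x : V}
    (h : m.proj (Finset.subset_univ A) = m'.proj (Finset.subset_univ A)) (v : Bool)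
    (hW : W ⊆ {x}) :
    (m.update x v).proj (Finset.subset_univ (A ∪ W)) =
      (m'.update x v).proj (Finset.subset_univ (A ∪ W)) := by
  funext y
  change (if y.1 = x then v else m ⟨y.1, _⟩) = (if y.1 = x then v else m' ⟨y.1, _⟩)
  split_ifs with hy
  · rfl
  · have hyA : y.1 ∈ A := (Finset.mem_union.1 y.2).resolve_right
      fun h => hy (Finset.mem_singleton.1 (hW h))
    exact congrFun h ⟨y.1, hyA⟩

/-- The output on `A ∪ WV` depends on the input on `A` only, if `A` includes `RV`. -/
theorem Com.marg_step_congr (c : Com V) : ∀ {A : Finset V}, c.rv ⊆ A →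
    ∀ {m m' : Mem (Finset.univ : Finset V)},
    m.proj (Finset.subset_univ A) = m'.proj (Finset.subset_univ A) →
    marg (Finset.subset_univ (A ∪ c.wv)) (c.step m) =
      marg (Finset.subset_univ (A ∪ c.wv)) (c.step m') := by
  have restr : ∀ {S T : Finset V} (_ : T ⊆ S) {μ μ' : PMF (Mem (Finset.univ : Finset V))},
      marg (Finset.subset_univ S) μ = marg (Finset.subset_univ S) μ' →
      marg (Finset.subset_univ T) μ = marg (Finset.subset_univ T) μ' := by
    intro S T h μ μ' he
    rw [← marg_marg (Finset.subset_univ S) h, ← marg_marg (Finset.subset_univ S) h, he]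
  induction c with
  | skip =>
    intro A _ m m' h
    refine (marg_pure _ _).trans (Eq.trans ?_ (marg_pure _ _).symm)
    congr 1
    funext y
    exact congrFun h ⟨y.1, (Finset.union_empty A).le y.2⟩
  | assn x e =>
    intro A hA m m' h
    refine (marg_pure _ _).trans (Eq.trans ?_ (marg_pure _ _).symm)
    have he : e.eval m = e.eval m' := by
      rw [← Exp.eval_proj (Finset.subset_univ A) m e hA, h, Exp.eval_proj _ _ _ hA]
    rw [he]
    exact congrArg PMF.pure (Mem.update_proj_congr h _ Finset.sdiff_subset)
  | samp x d =>
    intro A hA m m' h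
    have hd : m.proj (Finset.subset_univ d.fv) = m'.proj (Finset.subset_univ d.fv) :=
      congrArg (Mem.proj hA) h
    unfold Com.step
    rw [hd, marg_bind, marg_bind]
    congr 1
    funext v
    rw [marg_pure, marg_pure]
    exact congrArg PMF.pure (Mem.update_proj_congr h _ Finset.sdiff_subset)
  | seq c c' ih ih' =>
    intro A hA m m' h
    have hc : c.rv ⊆ A := Finset.subset_union_left.trans hA
    -- What c' reads is either written by c or read from the input, so the hypothesis for c' applies
    -- with A enlarged by WV(c).
    have hc' : c'.rv ⊆ A ∪ c.wv := by
      intro x hx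
      by_cases hw : x ∈ c.wv
      · exact Finset.mem_union_right _ hw
      · exact Finset.mem_union_left _
          (hA (Finset.mem_union_right _ (Finset.mem_sdiff.2 ⟨hx, hw⟩)))
    unfold Com.step
    rw [marg_bind, marg_bind]
    refine bind_congr_marg _ (ih hc h) fun m₁ m₂ h₁ => restr ?_ (ih' hc' h₁)
    change A ∪ (c.wv ∪ (c'.wv \ c.rv)) ⊆ _
    rw [← Finset.union_assoc]
    exact Finset.union_subset_union subset_rfl Finset.sdiff_subset
  | cond b c c' ih ih' =>
    intro A hA m m' h
    have hA' : {b} ∪ c.rv ∪ c'.rv ⊆ A := hA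
    have hb : b ∈ A := hA' (by simp)
    have hg : m.get b = m'.get b := by
      rw [← Mem.get_proj (Finset.subset_univ A) m hb, h, Mem.get_proj _ _ hb]
    unfold Com.step
    rw [hg]
    split_ifs
    · exact restr (Finset.union_subset_union subset_rfl
        (Finset.sdiff_subset.trans Finset.inter_subset_left))
        (ih (Finset.Subset.trans (fun x hx => by simp [hx]) hA') h)
    · exact restr (Finset.union_subset_union subset_rfl
        (Finset.sdiff_subset.trans Finset.inter_subset_right))
        (ih' (Finset.Subset.trans (fun x hx => by simp [hx]) hA') h)

/-- A command preserves independence of the variables that it uses and the variables that it does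
not modify. -/
theorem Com.marg_den_eq_indep (c : Com V) {A B T : Finset V}
    {μ : PMF (Mem (Finset.univ : Finset V))} (hA : c.rv ⊆ A) (hB : Disjoint B c.mv)
    (hT : T ⊆ A ∪ c.wv) (hAB : Disjoint A B)
    (h : marg (Finset.subset_univ (A ∪ B)) μ =
      indep subset_rfl (marg (Finset.subset_univ A) μ) (marg (Finset.subset_univ B) μ)) :
    marg (Finset.subset_univ (T ∪ B)) (c.den μ) =
      indep subset_rfl (marg (Finset.subset_univ T) (c.den μ))
        (marg (Finset.subset_univ B) μ) := by
  -- The filler `false` outside A is immaterial, since the law of the output on T depends on A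
  -- alone.
  set K : Mem A → PMF (Mem T) := fun a =>
    marg (Finset.subset_univ T) (c.step (a.extend Finset.univ)) with hK
  have hstep : ∀ m, marg (Finset.subset_univ T) (c.step m) =
      K (m.proj (Finset.subset_univ A)) := by
    intro m
    rw [hK]
    simp only
    rw [← marg_marg (Finset.subset_univ _) hT, ← marg_marg (Finset.subset_univ _) hT,
      c.marg_step_congr hA (Mem.proj_extend (Finset.subset_univ A) _).symm]
  have hstep' : ∀ m, marg (Finset.subset_univ (T ∪ B)) (c.step m) =
      (K (m.proj (Finset.subset_univ A))).map fun t =>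
        Mem.merge subset_rfl t (m.proj (Finset.subset_univ B)) := by
    intro m
    rw [← hstep]
    unfold marg
    rw [PMF.map_comp]
    refine map_congr_support _ fun m' hm' => ?_
    have : m.proj (Finset.subset_univ B) = m'.proj (Finset.subset_univ B) :=
      Mem.ext_get fun x hx => by
        rw [Mem.get_proj _ _ hx, Mem.get_proj _ _ hx,
          c.get_of_mem_support_step hm' x (Finset.disjoint_left.1 hB hx)]
    rw [this]
    exact (Mem.merge_self rfl (m'.proj (Finset.subset_univ (T ∪ B)))).symm
  have hden : marg (Finset.subset_univ T) (c.den μ) =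
      (marg (Finset.subset_univ A) μ).bind K := by
    rw [c.den_eq_bind, marg_bind, bind_marg]
    simp only [hstep]
  have hden' : marg (Finset.subset_univ (T ∪ B)) (c.den μ) =
      (marg (Finset.subset_univ (A ∪ B)) μ).bind fun m =>
        (K (m.proj Finset.subset_union_left)).map fun t =>
          Mem.merge subset_rfl t (m.proj Finset.subset_union_right) := by
    rw [c.den_eq_bind, marg_bind, bind_marg]
    simp only [hstep']
    rfl
  rw [hden, hden', h]
  unfold indep
  rw [PMF.bind_bind, PMF.bind_bind]
  congr 1
  funext a
  rw [PMF.bind_map]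
  have hab : ∀ b : Mem B, Mem.Agree a b := fun b x hxA hxB =>
    absurd hxB (Finset.disjoint_left.1 hAB hxA)
  have e1 : ∀ b : Mem B, (Mem.merge (subset_rfl : A ∪ B ⊆ A ∪ B) a b).proj
      Finset.subset_union_left = a := fun b =>
    Mem.merge_left (C := A) Finset.subset_union_left subset_rfl a b
  have e2 : ∀ b : Mem B, (Mem.merge (subset_rfl : A ∪ B ⊆ A ∪ B) a b).proj
      Finset.subset_union_right = b := fun b =>
    Mem.merge_right (C := B) Finset.subset_union_right subset_rfl (hab b)
  simp only [Function.comp_def, e1, e2]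
  unfold PMF.map
  -- Given the memory on A, the output on T and the memory on B are drawn independently, so their
  -- order is irrelevant.
  exact PMF.bind_comm _ _ _

end Programs

/-! ### Soundness of the rules -/

section Soundness

variable {V : Type*} [Fintype V] [DecidableEq V]

/-- The kernel that assigns to `x` a random value whose law depends on the variables in `S`. -/
def Kernel.draw {S D T : Finset V} (hS : S ⊆ D) (hT : D ⊆ T) (x : V) (hx : x ∉ D)
    (ρ : Mem S → PMF Bool) : Kernel V where
  dom := D
  cod := T
  dom_sub := hT
  run m := (ρ (m.proj hS)).map fun v => (m.extend T).update x v
  preserves m := by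
    unfold marg
    rw [PMF.map_comp]
    refine map_eq_pure fun v _ => funext fun y => ?_
    have hy : y.1 ≠ x := fun h => hx (h ▸ y.2)
    exact (if_neg hy).trans (Mem.get_of_mem m y.2)

/-- P mentions neither the old nor the new value of x, so it holds after x is forgotten. Forgetting
is necessary: a kernel that copies its inputs cannot overwrite one. -/
theorem Form.sat_dep_of_update {P : Form V} (hP : P.RDIBI) {x : V} {S : Finset V}
    (hxS : x ∉ S) (hxP : x ∉ P.fv) (ρ : Mem S → PMF Bool) (r : RForm V)
    (hr : ∀ m, r.Sat ((Kernel.draw subset_rfl (Finset.subset_insert x S) x hxS ρ).run m))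
    {μ : PMF (Mem (Finset.univ : Finset V))} (hμ : P.Sat (Kernel.lift μ)) :
    (Form.dep P (.atom S .top r)).Sat (Kernel.lift (μ.bind fun m =>
      (ρ (m.proj (Finset.subset_univ S))).map fun v => m.update x v)) := by
  have hSA : S ⊆ Finset.univ.erase x := fun y hy =>
    Finset.mem_erase.2 ⟨fun h => hxS (h ▸ hy), Finset.mem_univ y⟩
  obtain ⟨f, hf, hs, -, hc⟩ := hμ.exists_restriction hP
  have hcA : f.cod ⊆ Finset.univ.erase x := fun y hy =>
    Finset.mem_erase.2 ⟨fun h => hxP (h ▸ hc hy), Finset.mem_univ y⟩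
  refine ⟨Kernel.lift (marg (Finset.subset_univ (Finset.univ.erase x)) μ),
    Kernel.draw hSA (Finset.subset_univ _) x (Finset.notMem_erase x _) ρ,
    ⟨rfl, rfl, rfl, fun d => ?_⟩, hs.mono (hf.of_isMarg (Kernel.isMarg_lift_marg _ μ) hcA),
    Kernel.draw subset_rfl (Finset.subset_insert x S) x hxS ρ, IsMarg.le ?_,
    fun m _ => ⟨rfl, hr m⟩⟩
  · refine (marg_self _ _).trans (Eq.trans ?_ (bind_marg _ _ _).symm)
    refine congrArg (PMF.bind μ) (funext fun m => ?_)
    refine congrArg (fun g => PMF.map g _) (funext fun v => funext fun y => ?_)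
    change (if y.1 = x then v else m y) = if y.1 = x then v else
      Mem.get (Mem.proj (Finset.subset_univ (Finset.univ.erase x)) m) y.1
    split_ifs with hy
    · rfl
    · rw [Mem.get_of_mem _ (Finset.mem_erase.2 ⟨hy, y.2⟩)]
      rfl
  -- The draw with domain S lies below the one with all other variables as inputs, as its law
  -- depends only on S.
  · refine ⟨hSA, Finset.subset_univ _, fun y hy => ?_, fun d => ?_⟩
    · obtain ⟨h1, h2⟩ := Finset.mem_inter.1 hy
      exact (Finset.mem_insert.1 h1).resolve_left (Finset.mem_erase.1 h2).1
    · refine (PMF.map_comp _ _ _).trans ?_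
      refine congrArg (fun g => PMF.map g _) (funext fun v => funext fun y => ?_)
      change (if y.1 = x then v else Mem.get d y.1) =
        if y.1 = x then v else Mem.get (Mem.proj hSA d) y.1
      split_ifs with hy
      · rfl
      · exact (Mem.get_proj hSA d ((Finset.mem_insert.1 y.2).resolve_left hy)).symm

theorem valid_assn {P : Form V} {x : V} {e : Exp V} (hP : P.RDIBI) (hx : x ∉ e.fv ∪ P.fv) :
    Valid P (.assn x e) (.dep P (.atom e.fv .top (.eq x e))) := by
  intro μ hμ
  have hxe : x ∉ e.fv := fun h => hx (Finset.mem_union_left _ h)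
  have key := Form.sat_dep_of_update hP hxe (fun h => hx (Finset.mem_union_right _ h))
    (fun m => PMF.pure (e.eval m)) (.eq x e) ?_ hμ
  · convert key using 2
    unfold Com.den
    congr 1
    funext m
    rw [PMF.pure_map, Exp.eval_proj _ _ _ subset_rfl]
  · intro m
    refine ⟨Finset.insert_eq x e.fv ▸ subset_rfl, (prob_eq_one_iff _ _).2 fun a ha => ?_⟩
    have hm := Kernel.proj_of_mem_support _ ha
    have ha' := ha
    unfold Kernel.draw at ha'
    simp only [PMF.pure_map] at ha'
    have ha'' := (PMF.mem_support_pure_iff _ _).1 ha'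
    change a.get x = e.eval a
    have hav : a.get x = e.eval m := by
      rw [ha'']
      refine (Mem.get_update _ (Finset.mem_insert_self x _) _ _).trans ((if_pos rfl).trans ?_)
      exact Exp.eval_proj _ _ _ subset_rfl
    rw [hav, ← hm]
    exact Exp.eval_proj _ _ _ subset_rfl

theorem valid_samp {P : Form V} {x : V} {d : DExp V} (hP : P.RDIBI) (hx : x ∉ d.fv ∪ P.fv) :
    Valid P (.samp x d) (.dep P (.atom d.fv .top (.dist x d))) := by
  intro μ hμ
  have hxd : x ∉ d.fv := fun h => hx (Finset.mem_union_left _ h)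
  refine Form.sat_dep_of_update hP hxd (fun h => hx (Finset.mem_union_right _ h))
    d.eval (.dist x d) (fun m => ?_) hμ
  refine ⟨Finset.mem_insert_self x _, Finset.subset_insert x _, m, Kernel.preserves _ m, ?_⟩
  refine (PMF.map_comp _ _ _).trans (Eq.trans ?_ (PMF.map_id (d.eval m)))
  exact congrArg (fun g => PMF.map g _) (funext fun v => if_pos rfl)

/-- The states for R and Q are cut down to their variables: R then avoids MV(c), and Q lies where
the output is determined by the range of the state for P. Independence before the command thus gives
independence after it. -/
theorem valid_frame {P Q R : Form V} {c : Com V} (hP : P.RDIBI) (hQ : Q.RDIBI) (hR : R.RDIBI)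
    (hmv : R.fv ∩ c.mv = ∅) (hwv : Q.fv ⊆ P.fvR ∪ c.wv) (hrv : c.rv ⊆ P.fvR)
    (h : Valid P c Q) : Valid (.sep P R) c (.sep Q R) := by
  rintro μ ⟨k, g, r, hpar, hle, hg, hr⟩
  have hk := hle.isMarg
  obtain ⟨r', hr', hsr, -, hrc⟩ := hr.exists_restriction hR
  have hpar' := g.isPar_par r' ((IsMarg.refl g).inter_eq hr' hpar.compat)
  have hk' := (hpar.isMarg hpar' (IsMarg.refl g) hr').trans hk
  have hgμ := hpar'.isMarg_left.trans hk'
  have hrμ := hpar'.isMarg_right.trans hk'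
  obtain ⟨q, hq, hsq, -, hqc⟩ := (h μ (hg.mono hgμ)).exists_restriction hQ
  have hPg : P.fvR ⊆ g.cod := hg.fvR_subset hP
  -- Both domains are empty, so definedness of ⊕ forces the ranges apart.
  have hdis : Disjoint g.cod r'.cod := by
    rw [Finset.disjoint_iff_inter_eq_empty, ← hpar'.compat, ← Finset.subset_empty]
    exact Finset.inter_subset_left.trans hgμ.dom_sub
  have hmv' : Disjoint r'.cod c.mv :=
    (Finset.disjoint_iff_inter_eq_empty.2 hmv).mono_left hrc
  have hqA : q.cod ⊆ g.cod ∪ c.wv :=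
    hqc.trans (hwv.trans (Finset.union_subset_union hPg subset_rfl))
  have hqr : Disjoint q.cod r'.cod := by
    refine Disjoint.mono_left hqA (Finset.disjoint_union_left.2 ⟨hdis, ?_⟩)
    exact (hmv'.mono_right c.wv_subset_mv).symm
  have hc : q.dom ∩ r'.dom = q.cod ∩ r'.cod := by
    rw [Finset.disjoint_iff_inter_eq_empty.1 hqr, ← Finset.subset_empty]
    exact Finset.inter_subset_left.trans hq.dom_sub
  refine ⟨q.par r' hc, q, r', q.isPar_par r' hc, IsMarg.le ⟨?_, Finset.subset_univ _,
    Finset.inter_subset_right.trans (Finset.empty_subset _), fun d => ?_⟩, hsq, hsr⟩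
  · exact Finset.union_subset hq.dom_sub hrμ.dom_sub
  · have e1 := hk'.marg_run d
    have e2 := hgμ.marg_run d
    have e3 := hrμ.marg_run d
    have e4 := hq.marg_run d
    refine (c.marg_den_eq_indep (hrv.trans hPg) hmv' hqA hdis ?_).trans ?_
    · exact e1.trans (congrArg₂ (indep subset_rfl) e2.symm e3.symm)
    · exact congrArg₂ (indep subset_rfl) e4 e3

/-- Replacing the distribution of the guard by a constant: on the branch where the guard has the
value `v`, the input is the conditional distribution, and if this does not exist, there still is
some input that satisfies the precondition of the branch. -/
theorem exists_branch_input {P : Form V} {b : V} {μ : PMF (Mem (Finset.univ : Finset V))}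
    (h : (Form.dep (.atom ∅ .top (.mem {b})) P).Sat (Kernel.lift μ)) {e : Exp V} {v : Bool}
    (he : e.fv = ∅) (hev : ∀ (S : Finset V) (m : Mem S), e.eval m = v) :
    ∃ μ' : PMF (Mem (Finset.univ : Finset V)),
      (Form.dep (.atom ∅ .top (.eq b e)) P).Sat (Kernel.lift μ') ∧
      ((∃ m ∈ {m : Mem (Finset.univ : Finset V) | m.get b = v}, m ∈ μ.support) →
        μ' = condOn μ {m | m.get b = v}) := by
  classical
  obtain ⟨g, k, hseq, hg, hk⟩ := h
  have hb : b ∈ g.cod := by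
    obtain ⟨f, hf, hf'⟩ := hg
    obtain ⟨_, hm⟩ := hf' (fun _ => false) trivial
    exact hf.isMarg.cod_sub (hm (Finset.mem_singleton_self b))
  have d : Mem (∅ : Finset V) := fun _ => false
  set γ := g.run (Mem.proj hseq.dom_eq.ge d) with hγ
  set κ : Mem g.cod → PMF (Mem (Finset.univ : Finset V)) := fun m =>
    marg hseq.cod_eq.le (k.run (m.proj hseq.compat.ge)) with hκ
  have hμ : μ = γ.bind κ := by
    have := hseq.marg_run hseq.cod_eq.le subset_rfl d
    rw [marg_self] at this
    exact this
  have hκb : ∀ m, ∀ a ∈ (κ m).support, a.get b = m.get b := by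
    intro m a ha
    rw [hκ] at ha
    unfold marg at ha
    simp only [PMF.support_map] at ha
    obtain ⟨a, ha, rfl⟩ := ha
    have := congrFun (k.proj_of_mem_support ha) ⟨b, hseq.compat.le hb⟩
    rw [Mem.get_of_mem _ (Finset.mem_univ b), Mem.get_of_mem _ hb]
    exact this
  -- If the guard cannot be v, a constant memory replaces the conditional law; it still composes
  -- with the kernel for P.
  set γ' : PMF (Mem g.cod) := if ∃ m ∈ {m : Mem g.cod | m.get b = v}, m ∈ γ.support then
    condOn γ {m | m.get b = v} else PMF.pure fun _ => v with hγ'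
  have hsup : ∀ m ∈ γ'.support, m.get b = v := by
    intro m hm
    rw [hγ'] at hm
    split_ifs at hm with hex
    · exact mem_of_mem_support_condOn hex hm
    · rw [(PMF.mem_support_pure_iff _ _).1 hm, Mem.get_of_mem _ hb]
  refine ⟨γ'.bind κ, ⟨Kernel.lift γ', k, ⟨hseq.compat, rfl, hseq.cod_eq, fun _ => ?_⟩,
    Form.sat_atom_lift ⟨?_, ?_⟩, hk⟩, ?_⟩
  · refine (marg_bind _ _ _).trans ?_
    refine congrArg (PMF.bind γ') (funext fun m => ?_)
    exact (marg_marg _ _ _).trans (marg_self _ _)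
  · rw [he, Finset.union_empty]
    exact Finset.singleton_subset_iff.2 hb
  · exact (prob_eq_one_iff _ _).2 fun m hm => (hsup m hm).trans (hev _ m).symm
  · rintro ⟨a, hav, ha⟩
    rw [hμ] at ha
    obtain ⟨m, hm, ham⟩ := (PMF.mem_support_bind_iff _ _ _).1 ha
    have hex : ∃ m ∈ {m : Mem g.cod | m.get b = v}, m ∈ γ.support :=
      ⟨m, (hκb m a ham).symm.trans hav, hm⟩
    -- The second stage copies b, so conditioning its output amounts to conditioning the first
    -- stage.
    rw [hμ, condOn_bind (E := {m | m.get b = v}) _ hex, hγ', if_pos hex]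
    intro m _ a ha
    change a.get b = v ↔ m.get b = v
    rw [hκb m a ha]

/-- The guard is almost surely v, so the kernel witnessing the atom receives only the input v, and
its value there is a marginal of μ. -/
theorem branch_output {b : V} {μ : PMF (Mem (Finset.univ : Finset V))} {e : Exp V} {v : Bool}
    {r : RForm V}
    (h : (Form.dep (.atom ∅ .top (.eq b e)) (.atom {b} (.eq b e) r)).Sat (Kernel.lift μ))
    (hev : ∀ (S : Finset V) (m : Mem S), e.eval m = v) :
    (∀ m ∈ μ.support, m.get b = v) ∧ r.Sat μ := by
  obtain ⟨g, k, hseq, hg, f, hf, hr⟩ := h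
  have hb : ∀ m ∈ μ.support, m.get b = v := by
    intro m hm
    have := (hg.mono hseq.isMarg_left).rform_sat.2
    exact ((prob_eq_one_iff _ _).1 this m hm).trans (hev _ m)
  refine ⟨hb, ?_⟩
  have hfm := hf.isMarg
  obtain ⟨hd, hs⟩ := hr (fun _ => v) (by
    change Mem.get _ b = e.eval _
    rw [hev, Mem.get_of_mem _ (Finset.mem_singleton_self b)])
  have d : Mem (∅ : Finset V) := fun _ => false
  have e1 := hseq.marg_run hfm.cod_sub (Finset.subset_univ _) d
  have e2 := hseq.isMarg_left.marg_run d
  simp only [hfm.marg_run] at e1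
  have e3 : marg (Finset.subset_univ _) μ = f.run (Mem.proj hd.le fun _ => v) := by
    refine e1.trans ?_
    refine (congrArg (PMF.bind · _) e2.symm).trans ((bind_marg _ _ _).trans ?_)
    refine (bind_congr_support μ fun m hm => ?_).trans (PMF.bind_const μ _)
    refine congrArg f.run (funext fun y => ?_)
    have hy : y.1 = b := Finset.mem_singleton.1 (hd.le y.2)
    have h1 := hb m hm
    rw [← hy, Mem.get_of_mem _ (Finset.mem_univ y.1)] at h1
    exact h1
  rw [← e3] at hs
  exact RForm.sat_of_sat_marg _ hs

/-- The kernel sends a value of b to the corresponding branch output. Both values matter whatever ρ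
is, since the atoms quantify over inputs regardless of their probability. -/
theorem sat_of_branches {b : V} {Q₁ Q₂ : RForm V} (ρ : PMF Bool)
    (ν : Bool → PMF (Mem (Finset.univ : Finset V)))
    (hν : ∀ v, ∀ m ∈ (ν v).support, m.get b = v) (h₁ : Q₁.Sat (ν true))
    (h₂ : Q₂.Sat (ν false)) :
    (Form.dep (.atom ∅ .top (.mem {b})) (.and (.atom {b} (.eq b .tt) Q₁)
      (.atom {b} (.eq b .ff) Q₂))).Sat (Kernel.lift (ρ.bind ν)) := by
  let k : Kernel V :=
    { dom := {b}
      cod := Finset.univ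
      dom_sub := Finset.subset_univ _
      run := fun m => ν (m.get b)
      preserves := fun m => map_eq_pure fun a ha => Mem.ext_get fun x hx => by
        rw [Mem.get_proj _ _ hx, Finset.mem_singleton.1 hx]
        exact hν _ a ha }
  have hatom : ∀ (e : Exp V) (v : Bool) (Q : RForm V),
      (∀ (S : Finset V) (m : Mem S), e.eval m = v) → Q.Sat (ν v) →
      (Form.atom {b} (.eq b e) Q).Sat k := by
    intro e v Q hev hQ
    refine ⟨k, (IsMarg.refl k).le, fun m hm => ⟨rfl, ?_⟩⟩
    have hm' : m.get b = v := Eq.trans hm (hev _ m)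
    change Q.Sat (ν (m.get b))
    rwa [hm']
  refine ⟨Kernel.lift (ρ.map fun v => (fun _ => v : Mem ({b} : Finset V))), k,
    ⟨rfl, rfl, rfl, fun _ => ?_⟩, Form.sat_atom_lift (r := .mem {b}) (subset_rfl (a := {b})),
    hatom .tt true Q₁ (fun _ _ => rfl) h₁, hatom .ff false Q₂ (fun _ _ => rfl) h₂⟩
  refine (marg_self _ _).trans (Eq.trans ?_ (PMF.bind_map _ _ _).symm)
  refine congrArg (PMF.bind ρ) (funext fun v => congrArg ν ?_)
  exact (Mem.get_of_mem (S := {b}) (fun _ => v) (Finset.mem_singleton_self b)).symm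

theorem valid_cond {P : Form V} {b : V} {c c' : Com V} {Q₁ Q₂ : RForm V}
    (h₁ : Valid (.dep (.atom ∅ .top (.eq b .tt)) P) c
      (.dep (.atom ∅ .top (.eq b .tt)) (.atom {b} (.eq b .tt) Q₁)))
    (h₂ : Valid (.dep (.atom ∅ .top (.eq b .ff)) P) c'
      (.dep (.atom ∅ .top (.eq b .ff)) (.atom {b} (.eq b .ff) Q₂))) :
    Valid (.dep (.atom ∅ .top (.mem {b})) P) (.cond b c c')
      (.dep (.atom ∅ .top (.mem {b}))
        (.and (.atom {b} (.eq b .tt) Q₁) (.atom {b} (.eq b .ff) Q₂))) := by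
  intro μ hμ
  obtain ⟨μ₁, hμ₁, he₁⟩ := exists_branch_input hμ (e := .tt) (v := true) rfl fun _ _ => rfl
  obtain ⟨μ₂, hμ₂, he₂⟩ := exists_branch_input hμ (e := .ff) (v := false) rfl fun _ _ => rfl
  obtain ⟨hb₁, hQ₁⟩ := branch_output (v := true) (h₁ μ₁ hμ₁) fun _ _ => rfl
  obtain ⟨hb₂, hQ₂⟩ := branch_output (v := false) (h₂ μ₂ hμ₂) fun _ _ => rfl
  have hden : (Com.cond b c c').den μ = (μ.map fun m => m.get b).bind fun v =>
      if v then c.den μ₁ else c'.den μ₂ := by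
    rw [Com.den_cond_eq_bind]
    refine bind_congr_support _ fun v hv => ?_
    have hex := exists_of_mem_support_map hv
    cases v with
    | true => rw [if_pos rfl, if_pos rfl, he₁ hex]
    | false => rw [if_neg Bool.false_ne_true, if_neg Bool.false_ne_true, he₂ hex]
  rw [hden]
  refine sat_of_branches _ _ (fun v => ?_) hQ₁ hQ₂
  cases v with
  | true => exact hb₁
  | false => exact hb₂

end Soundness

end

end CPSL

/-- Soundness of Conditional Probabilistic Separation Logic: derivable judgments are valid. -/
theorem mainTheorem11 {V : Type*} [Fintype V] [DecidableEq V]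
    {P Q : CPSL.Form V} {c : CPSL.Com V} (h : CPSL.Derivable P c Q) :
    CPSL.Valid P c Q := by
  induction h with
  | assn hP _ hx => exact CPSL.valid_assn hP hx
  | samp hP _ hx => exact CPSL.valid_samp hP hx
  | skip _ => exact fun _ h => h
  | seqn _ _ ih ih' => exact fun μ h => ih' _ (ih μ h)
  | dcond _ _ _ _ ih ih' => exact CPSL.valid_cond ih ih'
  | weak _ _ hP hQ _ ih =>
    exact fun μ h => hQ _ _ (CPSL.IsMarg.refl _).le (ih μ (hP _ _ (CPSL.IsMarg.refl _).le h))
  | frame hR hmv hwv hrv hd ih =>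
    exact CPSL.valid_frame hd.rdibi.1 hd.rdibi.2 hR hmv hwv hrv ih
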